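/- Let $0<\rho<1/3$ and $0<\sigma<1/3$, and put $\alpha=\rho^{-1}$. Let $f:[0,1]\to[0,1]$ be $f(y)=\frac{1}{1-(1-1/y)e^{-1}}$ for $y>0$ and $f(0)=0$, let $g_0=f^{-1}:[0,1]\to[0,1]$, and let $g_1(y)=1-\sigma^{-1}y$. In $\mathbb{R}^3$ consider the pairwise disjoint rectangles $$R_1=[0,\rho]\times[0,1]\times\{0\},\quad R_2=[3/4-\rho,3/4]\times[0,\sigma]\times\{0\},\quad R_3=[0,\rho]\times[0,1]\times\{5/6\},$$ and the map $G$ on $R_1\cup R_2\cup R_3$ given by $G(x,y,z)=(\alpha x,g_0(y),0)$ on $R_1$ and on $R_3$, and $G(x,y,z)=(\alpha(3/4-x),g_1(y),5/6)$ on $R_2$. Let $\Lambda=\bigcap_{n\ge0}G^{-n}(R_1\cup R_2\cup R_3)$ be the maximal invariant set, which is compact, and write $G:\Lambda\to\Lambda$ for the restriction. Let $\phi:\Lambda\to\mathbb{R}$ be Hölder continuous with $$\sup\phi-\inf\phi<\tfrac12\log\omega,\qquad \omega=\frac{1+\sqrt5}{2}.$$ Let $\mathcal{L}_\phi:C(\Lambda)\to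 C(\Lambda)$ be the Ruelle–Perron–Frobenius operator on the real continuous functions with the supremum norm, $\mathcal{L}_\phi\psi(x)=\sum_{y\in G^{-1}(x)}e^{\phi(y)}\psi(y)$, let $\mathcal{L}_\phi^*$ be its dual acting on finite Borel measures on $\Lambda$ by $\int\psi\,d\mathcal{L}_\phi^*\eta=\int\mathcal{L}_\phi\psi\,d\eta$ for all $\psi\in C(\Lambda)$, and let $\lambda=\limsup_{n\to\infty}\|\mathcal{L}_\phi^n\|^{1/n}$ be the spectral radius of $\mathcal{L}_\phi$. Then there exist a Borel probability measure $\nu$ on $\Lambda$ and a function $h:\Lambda\to\mathbb{R}$ that is Hölder continuous (for some exponent in $(0,1]$) and satisfies $h(x)>0$ for every $x\in\Lambda$, such that $$\mathcal{L}_\phi^*\nu=\lambda\nu\qquad\text{and}\qquad\mathcal{L}_\phi h=\lambda h.$$ -/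

import Mathlib

namespace HorseshoeProjection

/-- The parameters of the map: the contraction rate `ρ` of the stable direction and the slope `σ`
of the orientation reversing branch in the central direction. -/
structure Params where
  ρ : ℝ
  σ : ℝ
  ρ_pos : 0 < ρ
  ρ_lt : ρ < 1 / 3
  σ_pos : 0 < σ
  σ_lt : σ < 1 / 3

/-- `f y = 1 / (1 - (1 - 1 / y) e⁻¹)`, extended by continuity by `f 0 = 0`. -/
noncomputable def f (y : ℝ) : ℝ :=
  if y = 0 then 0 else 1 / (1 - (1 - 1 / y) * Real.exp (-1))

/-- The inverse of `f : [0, 1] → [0, 1]`, in closed form (see `invOn_g₀_f`). -/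
noncomputable def g₀ (y : ℝ) : ℝ := y / (Real.exp 1 - (Real.exp 1 - 1) * y)

/-- `f` in closed form on all of `[0, 1]`. -/
theorem f_eq {y : ℝ} (hy : 0 ≤ y) :
    f y = Real.exp 1 * y / (1 + (Real.exp 1 - 1) * y) := by
  have he : 1 < Real.exp 1 := by simp
  unfold f
  split_ifs with h
  · simp [h]
  · have hy' : 0 < y := lt_of_le_of_ne hy (Ne.symm h)
    have h1 : 0 < 1 + (Real.exp 1 - 1) * y := by nlinarith
    rw [Real.exp_neg]
    have h2 : 1 - (1 - 1 / y) * (Real.exp 1)⁻¹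
        = (1 + (Real.exp 1 - 1) * y) / (Real.exp 1 * y) := by
      field_simp
      ring
    rw [h2, one_div_div]

theorem den_g₀_pos {y : ℝ} (hy : y ∈ Set.Icc (0 : ℝ) 1) :
    0 < Real.exp 1 - (Real.exp 1 - 1) * y := by
  have he : 1 < Real.exp 1 := by simp
  nlinarith [hy.1, hy.2]

theorem den_f_pos {y : ℝ} (hy : y ∈ Set.Icc (0 : ℝ) 1) :
    0 < 1 + (Real.exp 1 - 1) * y := by
  have he : 1 < Real.exp 1 := by simp
  nlinarith [hy.1, hy.2]

theorem mapsTo_f : Set.MapsTo f (Set.Icc 0 1) (Set.Icc 0 1) := by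
  intro y hy
  have he : 1 < Real.exp 1 := by simp
  have h := den_f_pos hy
  rw [f_eq hy.1]
  refine ⟨div_nonneg (mul_nonneg (by linarith) hy.1) h.le, ?_⟩
  rw [div_le_one h]
  linarith [hy.2]

theorem mapsTo_g₀ : Set.MapsTo g₀ (Set.Icc 0 1) (Set.Icc 0 1) := by
  intro y hy
  have he : 1 < Real.exp 1 := by simp
  have h := den_g₀_pos hy
  refine ⟨div_nonneg hy.1 h.le, ?_⟩
  unfold g₀
  rw [div_le_one h]
  nlinarith [hy.2]

/-- `g₀` is the inverse function of `f` on `[0, 1]`. -/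
theorem invOn_g₀_f : Set.InvOn g₀ f (Set.Icc 0 1) (Set.Icc 0 1) := by
  have he : 1 < Real.exp 1 := by simp
  refine ⟨fun y hy => ?_, fun y hy => ?_⟩
  · have h := den_f_pos hy
    have h2 := den_g₀_pos (mapsTo_f hy)
    rw [f_eq hy.1] at h2 ⊢
    unfold g₀
    rw [div_eq_iff h2.ne']
    have hq := div_mul_cancel₀ (Real.exp 1 * y) h.ne'
    linear_combination hq
  · have h := den_g₀_pos hy
    have h2 := den_f_pos (mapsTo_g₀ hy)
    rw [f_eq (mapsTo_g₀ hy).1]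
    unfold g₀ at h2 ⊢
    rw [div_eq_iff h2.ne']
    have hq := div_mul_cancel₀ y h.ne'
    linear_combination hq

theorem continuousOn_f : ContinuousOn f (Set.Icc 0 1) := by
  have : ContinuousOn (fun y : ℝ => Real.exp 1 * y / (1 + (Real.exp 1 - 1) * y))
      (Set.Icc 0 1) :=
    ContinuousOn.div (by fun_prop) (by fun_prop) (fun y hy => (den_f_pos hy).ne')
  exact this.congr fun y hy => f_eq hy.1

theorem continuousOn_g₀ : ContinuousOn g₀ (Set.Icc 0 1) :=
  ContinuousOn.div (by fun_prop) (by fun_prop) (fun _ hy => (den_g₀_pos hy).ne')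

variable (P : Params)

/-- The affine branch `g₁ y = 1 - σ⁻¹ y`. -/
noncomputable def g₁ (y : ℝ) : ℝ := 1 - P.σ⁻¹ * y

/-- The rectangle `R₁ = [0, ρ] × [0, 1] × {0}`. -/
def R₁ : Set (ℝ × ℝ × ℝ) := Set.Icc 0 P.ρ ×ˢ Set.Icc 0 1 ×ˢ {0}

/-- The rectangle `R₂ = [3/4 - ρ, 3/4] × [0, σ] × {0}`. -/
def R₂ : Set (ℝ × ℝ × ℝ) := Set.Icc (3 / 4 - P.ρ) (3 / 4) ×ˢ Set.Icc 0 P.σ ×ˢ {0}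

/-- The rectangle `R₃ = [0, ρ] × [0, 1] × {5/6}`. -/
def R₃ : Set (ℝ × ℝ × ℝ) := Set.Icc 0 P.ρ ×ˢ Set.Icc 0 1 ×ˢ {5 / 6}

/-- The union of the three rectangles, the domain of the piecewise map. -/
def R : Set (ℝ × ℝ × ℝ) := R₁ P ∪ R₂ P ∪ R₃ P

open Classical in
/-- The piecewise map, with `α = ρ⁻¹`. The value off the three rectangles plays no role. -/
noncomputable def Gmap (p : ℝ × ℝ × ℝ) : ℝ × ℝ × ℝ :=
  if p ∈ R₁ P then (P.ρ⁻¹ * p.1, g₀ p.2.1, 0)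
  else if p ∈ R₂ P then (P.ρ⁻¹ * (3 / 4 - p.1), g₁ P p.2.1, 5 / 6)
  else if p ∈ R₃ P then (P.ρ⁻¹ * p.1, g₀ p.2.1, 0)
  else p

/-- The maximal invariant set: the points whose forward orbit never leaves the rectangles. -/
def Lam : Set (ℝ × ℝ × ℝ) := ⋂ n : ℕ, (Gmap P)^[n] ⁻¹' R P

variable {P}

theorem mem_Lam {p : ℝ × ℝ × ℝ} : p ∈ Lam P ↔ ∀ n, (Gmap P)^[n] p ∈ R P := by
  simp [Lam]

theorem mem_R_of_mem_Lam {p : ℝ × ℝ × ℝ} (hp : p ∈ Lam P) : p ∈ R P := mem_Lam.1 hp 0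

theorem mem_Lam_iff {p : ℝ × ℝ × ℝ} : p ∈ Lam P ↔ p ∈ R P ∧ Gmap P p ∈ Lam P := by
  simp only [mem_Lam]
  constructor
  · exact fun h => ⟨h 0, fun n => h (n + 1)⟩
  · rintro ⟨h0, h⟩ n
    cases n with
    | zero => exact h0
    | succ n => exact h n

theorem mapsTo_Gmap : Set.MapsTo (Gmap P) (Lam P) (Lam P) := fun _ hp => (mem_Lam_iff.1 hp).2

variable (P)

/-- The map `G : Λ → Λ`. -/
noncomputable def G : Lam P → Lam P := mapsTo_Gmap.restrict (Gmap P) (Lam P) (Lam P)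

variable {P}

theorem Gmap_R₁ {p : ℝ × ℝ × ℝ} (h : p ∈ R₁ P) :
    Gmap P p = (P.ρ⁻¹ * p.1, g₀ p.2.1, 0) := by
  simp [Gmap, h]

theorem Gmap_R₂ {p : ℝ × ℝ × ℝ} (h : p ∈ R₂ P) :
    Gmap P p = (P.ρ⁻¹ * (3 / 4 - p.1), g₁ P p.2.1, 5 / 6) := by
  have h1 : p ∉ R₁ P := fun h1 => by
    have := P.ρ_lt
    linarith [h.1.1, h1.1.2]
  simp [Gmap, h, h1]

theorem Gmap_R₃ {p : ℝ × ℝ × ℝ} (h : p ∈ R₃ P) :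
    Gmap P p = (P.ρ⁻¹ * p.1, g₀ p.2.1, 0) := by
  have hz : p.2.2 = 5 / 6 := h.2.2
  have h1 : p ∉ R₁ P := fun h1 => by
    have hz' : p.2.2 = 0 := h1.2.2
    norm_num [hz] at hz'
  have h2 : p ∉ R₂ P := fun h1 => by
    have hz' : p.2.2 = 0 := h1.2.2
    norm_num [hz] at hz'
  simp [Gmap, h, h1, h2]

theorem isClosed_R₁ : IsClosed (R₁ P) := isClosed_Icc.prod (isClosed_Icc.prod isClosed_singleton)
theorem isClosed_R₂ : IsClosed (R₂ P) := isClosed_Icc.prod (isClosed_Icc.prod isClosed_singleton)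
theorem isClosed_R₃ : IsClosed (R₃ P) := isClosed_Icc.prod (isClosed_Icc.prod isClosed_singleton)

theorem isCompact_R : IsCompact (R P) :=
  ((isCompact_Icc.prod (isCompact_Icc.prod isCompact_singleton)).union
    (isCompact_Icc.prod (isCompact_Icc.prod isCompact_singleton))).union
    (isCompact_Icc.prod (isCompact_Icc.prod isCompact_singleton))

theorem continuousOn_Gmap : ContinuousOn (Gmap P) (R P) := by
  have h1 : ContinuousOn (Gmap P) (R₁ P) := by
    have : ContinuousOn (fun p : ℝ × ℝ × ℝ => (P.ρ⁻¹ * p.1, g₀ p.2.1, (0 : ℝ))) (R₁ P) := by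
      refine ContinuousOn.prodMk (by fun_prop) (ContinuousOn.prodMk ?_ (by fun_prop))
      exact continuousOn_g₀.comp (by fun_prop) (fun p hp => hp.2.1)
    exact this.congr fun p hp => Gmap_R₁ hp
  have h2 : ContinuousOn (Gmap P) (R₂ P) := by
    have : ContinuousOn
        (fun p : ℝ × ℝ × ℝ => (P.ρ⁻¹ * (3 / 4 - p.1), g₁ P p.2.1, (5 / 6 : ℝ))) (R₂ P) := by
      unfold g₁
      fun_prop
    exact this.congr fun p hp => Gmap_R₂ hp
  have h3 : ContinuousOn (Gmap P) (R₃ P) := by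
    have : ContinuousOn (fun p : ℝ × ℝ × ℝ => (P.ρ⁻¹ * p.1, g₀ p.2.1, (0 : ℝ))) (R₃ P) := by
      refine ContinuousOn.prodMk (by fun_prop) (ContinuousOn.prodMk ?_ (by fun_prop))
      exact continuousOn_g₀.comp (by fun_prop) (fun p hp => hp.2.1)
    exact this.congr fun p hp => Gmap_R₃ hp
  exact (h1.union_of_isClosed h2 isClosed_R₁ isClosed_R₂).union_of_isClosed h3
    (isClosed_R₁.union isClosed_R₂) isClosed_R₃

theorem isCompact_Lam : IsCompact (Lam P) := by
  have key : ∀ n : ℕ, IsClosed {p | ∀ k ≤ n, (Gmap P)^[k] p ∈ R P} := by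
    intro n
    induction n with
    | zero => simpa using isCompact_R.isClosed
    | succ n ih =>
      have : {p | ∀ k ≤ n + 1, (Gmap P)^[k] p ∈ R P}
          = R P ∩ Gmap P ⁻¹' {p | ∀ k ≤ n, (Gmap P)^[k] p ∈ R P} := by
        ext p
        constructor
        · exact fun h => ⟨h 0 (by omega), fun k hk => h (k + 1) (by omega)⟩
        · rintro ⟨h0, h⟩ k hk
          cases k with
          | zero => exact h0
          | succ k => exact h k (by omega)
      rw [this]
      exact continuousOn_Gmap.preimage_isClosed_of_isClosed isCompact_R.isClosed ih
  have hc : IsClosed (Lam P) := by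
    have : Lam P = ⋂ n : ℕ, {p | ∀ k ≤ n, (Gmap P)^[k] p ∈ R P} := by
      ext p
      simp only [mem_Lam, Set.mem_iInter, Set.mem_ofPred_eq]
      exact ⟨fun h n k _ => h k, fun h n => h n n le_rfl⟩
    rw [this]
    exact isClosed_iInter key
  exact isCompact_R.of_isClosed_subset hc fun _ hp => mem_R_of_mem_Lam hp

instance : CompactSpace (Lam P) := isCompact_iff_compactSpace.1 isCompact_Lam

/-- The transfer operator on functions: `x ↦ ∑ exp (φ y) ψ y` over the preimages `y` of `x`. -/
noncomputable def transferFun (φ ψ : Lam P → ℝ) (x : Lam P) : ℝ :=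
  ∑ᶠ y ∈ G P ⁻¹' {x}, Real.exp (φ y) * ψ y

/-! ### The transfer operator is a bounded operator on continuous functions -/

/-- The lower plane, as a subset of `Λ`. -/
def low (P : Params) : Set (Lam P) := {p | p.1.2.2 = 0}

theorem z_cases (p : Lam P) : p.1.2.2 = 0 ∨ p.1.2.2 = 5 / 6 := by
  rcases mem_R_of_mem_Lam p.2 with (h | h) | h
  · exact Or.inl h.2.2
  · exact Or.inl h.2.2
  · exact Or.inr h.2.2

theorem x_mem (p : Lam P) : p.1.1 ∈ Set.Icc (0 : ℝ) 1 := by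
  have h1 := P.ρ_pos
  have h2 := P.ρ_lt
  rcases mem_R_of_mem_Lam p.2 with (h | h) | h
  · exact ⟨h.1.1, by linarith [h.1.2]⟩
  · exact ⟨by linarith [h.1.1], by linarith [h.1.2]⟩
  · exact ⟨h.1.1, by linarith [h.1.2]⟩

theorem y_mem (p : Lam P) : p.1.2.1 ∈ Set.Icc (0 : ℝ) 1 := by
  have h2 := P.σ_lt
  rcases mem_R_of_mem_Lam p.2 with (h | h) | h
  · exact h.2.1
  · exact ⟨h.2.1.1, by linarith [h.2.1.2]⟩
  · exact h.2.1

theorem isClopen_low : IsClopen (low P) := by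
  have hcont : Continuous fun p : Lam P => p.1.2.2 := by fun_prop
  refine ⟨isClosed_eq hcont continuous_const, ?_⟩
  have : low P = {p : Lam P | p.1.2.2 < 1 / 2} := by
    ext p
    rcases z_cases p with h | h <;> norm_num [low, h]
  rw [this]
  exact isOpen_lt hcont continuous_const

theorem rho_mul_mem (p : Lam P) : P.ρ * p.1.1 ∈ Set.Icc 0 P.ρ :=
  ⟨mul_nonneg P.ρ_pos.le (x_mem p).1, by nlinarith [P.ρ_pos, (x_mem p).2]⟩

theorem mem_b₁ (p : Lam P) : (P.ρ * p.1.1, f p.1.2.1, (0 : ℝ)) ∈ R₁ P :=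
  ⟨rho_mul_mem p, mapsTo_f (y_mem p), rfl⟩

theorem mem_b₃ (p : Lam P) : (P.ρ * p.1.1, f p.1.2.1, (5 / 6 : ℝ)) ∈ R₃ P :=
  ⟨rho_mul_mem p, mapsTo_f (y_mem p), rfl⟩

theorem mem_b₂ (p : Lam P) :
    (3 / 4 - P.ρ * p.1.1, P.σ * (1 - p.1.2.1), (0 : ℝ)) ∈ R₂ P := by
  have h := rho_mul_mem p
  have hy := y_mem p
  have hs := P.σ_pos
  refine ⟨⟨?_, ?_⟩, ⟨?_, ?_⟩, rfl⟩
  · show 3 / 4 - P.ρ ≤ 3 / 4 - P.ρ * p.1.1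
    linarith [h.2]
  · show 3 / 4 - P.ρ * p.1.1 ≤ 3 / 4
    linarith [h.1]
  · exact mul_nonneg hs.le (by linarith [hy.2])
  · show P.σ * (1 - p.1.2.1) ≤ P.σ
    nlinarith [hy.1]

theorem Gmap_b₁ {p : Lam P} (hp : p ∈ low P) :
    Gmap P (P.ρ * p.1.1, f p.1.2.1, (0 : ℝ)) = p.1 := by
  rw [Gmap_R₁ (mem_b₁ p)]
  refine Prod.ext ?_ (Prod.ext ?_ ?_)
  · simp [P.ρ_pos.ne']
  · exact invOn_g₀_f.1 (y_mem p)
  · exact (show p.1.2.2 = 0 from hp).symm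

theorem Gmap_b₃ {p : Lam P} (hp : p ∈ low P) :
    Gmap P (P.ρ * p.1.1, f p.1.2.1, (5 / 6 : ℝ)) = p.1 := by
  rw [Gmap_R₃ (mem_b₃ p)]
  refine Prod.ext ?_ (Prod.ext ?_ ?_)
  · simp [P.ρ_pos.ne']
  · exact invOn_g₀_f.1 (y_mem p)
  · exact (show p.1.2.2 = 0 from hp).symm

theorem Gmap_b₂ {p : Lam P} (hp : p ∉ low P) :
    Gmap P (3 / 4 - P.ρ * p.1.1, P.σ * (1 - p.1.2.1), (0 : ℝ)) = p.1 := by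
  rw [Gmap_R₂ (mem_b₂ p)]
  refine Prod.ext ?_ (Prod.ext ?_ ?_)
  · simp [P.ρ_pos.ne']
  · simp [g₁, P.σ_pos.ne']
  · exact ((z_cases p).resolve_left hp).symm

open Classical in
/-- The inverse branch onto `R₁`, defined on the lower plane (and the identity elsewhere). -/
noncomputable def b₁ (p : Lam P) : Lam P :=
  if hp : p ∈ low P then ⟨(P.ρ * p.1.1, f p.1.2.1, 0),
    mem_Lam_iff.2 ⟨Or.inl (Or.inl (mem_b₁ p)), by rw [Gmap_b₁ hp]; exact p.2⟩⟩ else p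

open Classical in
/-- The inverse branch onto `R₃`, defined on the lower plane (and the identity elsewhere). -/
noncomputable def b₃ (p : Lam P) : Lam P :=
  if hp : p ∈ low P then ⟨(P.ρ * p.1.1, f p.1.2.1, 5 / 6),
    mem_Lam_iff.2 ⟨Or.inr (mem_b₃ p), by rw [Gmap_b₃ hp]; exact p.2⟩⟩ else p

open Classical in
/-- The inverse branch onto `R₂`, defined on the upper plane (and the identity elsewhere). -/
noncomputable def b₂ (p : Lam P) : Lam P :=
  if hp : p ∈ low P then p else ⟨(3 / 4 - P.ρ * p.1.1, P.σ * (1 - p.1.2.1), 0),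
    mem_Lam_iff.2 ⟨Or.inl (Or.inr (mem_b₂ p)), by rw [Gmap_b₂ hp]; exact p.2⟩⟩

theorem b₁_val {p : Lam P} (hp : p ∈ low P) : (b₁ p).1 = (P.ρ * p.1.1, f p.1.2.1, 0) := by
  simp [b₁, hp]

theorem b₃_val {p : Lam P} (hp : p ∈ low P) :
    (b₃ p).1 = (P.ρ * p.1.1, f p.1.2.1, 5 / 6) := by
  simp [b₃, hp]

theorem b₂_val {p : Lam P} (hp : p ∉ low P) :
    (b₂ p).1 = (3 / 4 - P.ρ * p.1.1, P.σ * (1 - p.1.2.1), 0) := by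
  simp [b₂, hp]

theorem continuous_f_comp : Continuous fun p : Lam P => f p.1.2.1 :=
  continuousOn_f.comp_continuous (by fun_prop) y_mem

theorem continuous_b₁ : Continuous (b₁ : Lam P → Lam P) := by
  classical
  refine Topology.IsInducing.subtypeVal.continuous_iff.2 ?_
  have : (Subtype.val ∘ b₁ : Lam P → _)
      = fun p => if p ∈ low P then (P.ρ * p.1.1, f p.1.2.1, 0) else p.1 := by
    funext p
    by_cases hp : p ∈ low P <;> simp [b₁, hp]
  rw [this]
  refine Continuous.if (fun p hp => ?_) ?_ continuous_subtype_val
  · change p ∈ frontier (low P) at hp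
    simp [isClopen_low.frontier_eq] at hp
  · have := continuous_f_comp (P := P)
    fun_prop

theorem continuous_b₃ : Continuous (b₃ : Lam P → Lam P) := by
  classical
  refine Topology.IsInducing.subtypeVal.continuous_iff.2 ?_
  have : (Subtype.val ∘ b₃ : Lam P → _)
      = fun p => if p ∈ low P then (P.ρ * p.1.1, f p.1.2.1, 5 / 6) else p.1 := by
    funext p
    by_cases hp : p ∈ low P <;> simp [b₃, hp]
  rw [this]
  refine Continuous.if (fun p hp => ?_) ?_ continuous_subtype_val
  · change p ∈ frontier (low P) at hp
    simp [isClopen_low.frontier_eq] at hp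
  · have := continuous_f_comp (P := P)
    fun_prop

theorem continuous_b₂ : Continuous (b₂ : Lam P → Lam P) := by
  classical
  refine Topology.IsInducing.subtypeVal.continuous_iff.2 ?_
  have : (Subtype.val ∘ b₂ : Lam P → _) = fun p => if p ∈ low P then p.1 else
      (3 / 4 - P.ρ * p.1.1, P.σ * (1 - p.1.2.1), 0) := by
    funext p
    by_cases hp : p ∈ low P <;> simp [b₂, hp]
  rw [this]
  refine Continuous.if (fun p hp => ?_) continuous_subtype_val ?_
  · change p ∈ frontier (low P) at hp
    simp [isClopen_low.frontier_eq] at hp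
  · fun_prop

theorem b₁_ne_b₃ {p : Lam P} (hp : p ∈ low P) : b₁ p ≠ b₃ p := by
  intro h
  have := congrArg Subtype.val h
  rw [b₁_val hp, b₃_val hp] at this
  norm_num at this

/-- A point of the lower plane has exactly two preimages. -/
theorem preimage_low {p : Lam P} (hp : p ∈ low P) : G P ⁻¹' {p} = {b₁ p, b₃ p} := by
  have hz : p.1.2.2 = 0 := hp
  ext q
  simp only [Set.mem_preimage, Set.mem_singleton_iff, Set.mem_insert_iff]
  constructor
  · rintro rfl
    change (Gmap P q.1).2.2 = 0 at hz
    rcases mem_R_of_mem_Lam q.2 with (h | h) | h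
    · left
      apply Subtype.ext
      rw [b₁_val hp]
      change q.1 = (P.ρ * (Gmap P q.1).1, f (Gmap P q.1).2.1, 0)
      rw [Gmap_R₁ h]
      exact Prod.ext (by simp [P.ρ_pos.ne'])
        (Prod.ext (invOn_g₀_f.2 h.2.1).symm h.2.2)
    · rw [Gmap_R₂ h] at hz
      norm_num at hz
    · right
      apply Subtype.ext
      rw [b₃_val hp]
      change q.1 = (P.ρ * (Gmap P q.1).1, f (Gmap P q.1).2.1, 5 / 6)
      rw [Gmap_R₃ h]
      exact Prod.ext (by simp [P.ρ_pos.ne'])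
        (Prod.ext (invOn_g₀_f.2 h.2.1).symm h.2.2)
  · rintro (rfl | rfl)
    · apply Subtype.ext
      change Gmap P (b₁ p).1 = p.1
      rw [b₁_val hp, Gmap_b₁ hp]
    · apply Subtype.ext
      change Gmap P (b₃ p).1 = p.1
      rw [b₃_val hp, Gmap_b₃ hp]

/-- A point of the upper plane has exactly one preimage. -/
theorem preimage_up {p : Lam P} (hp : p ∉ low P) : G P ⁻¹' {p} = {b₂ p} := by
  ext q
  simp only [Set.mem_preimage, Set.mem_singleton_iff]
  constructor
  · rintro rfl
    have hz : (Gmap P q.1).2.2 ≠ 0 := hp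
    rcases mem_R_of_mem_Lam q.2 with (h | h) | h
    · rw [Gmap_R₁ h] at hz
      exact absurd rfl hz
    · apply Subtype.ext
      rw [b₂_val hp]
      change q.1 = (3 / 4 - P.ρ * (Gmap P q.1).1, P.σ * (1 - (Gmap P q.1).2.1), 0)
      rw [Gmap_R₂ h]
      exact Prod.ext (by simp [P.ρ_pos.ne'])
        (Prod.ext (by simp [g₁, P.σ_pos.ne']) h.2.2)
    · rw [Gmap_R₃ h] at hz
      exact absurd rfl hz
  · rintro rfl
    apply Subtype.ext
    change Gmap P (b₂ p).1 = p.1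
    rw [b₂_val hp, Gmap_b₂ hp]

theorem transferFun_low (φ ψ : Lam P → ℝ) {p : Lam P} (hp : p ∈ low P) :
    transferFun φ ψ p
      = Real.exp (φ (b₁ p)) * ψ (b₁ p) + Real.exp (φ (b₃ p)) * ψ (b₃ p) := by
  rw [transferFun, preimage_low hp]
  exact finsum_mem_pair (b₁_ne_b₃ hp)

theorem transferFun_up (φ ψ : Lam P → ℝ) {p : Lam P} (hp : p ∉ low P) :
    transferFun φ ψ p = Real.exp (φ (b₂ p)) * ψ (b₂ p) := by
  rw [transferFun, preimage_up hp]
  exact finsum_mem_singleton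

theorem continuous_transferFun (φ ψ : C(Lam P, ℝ)) : Continuous (transferFun φ ψ) := by
  classical
  have h : transferFun φ ψ = fun p => if p ∈ low P then
      Real.exp (φ (b₁ p)) * ψ (b₁ p) + Real.exp (φ (b₃ p)) * ψ (b₃ p)
      else Real.exp (φ (b₂ p)) * ψ (b₂ p) := by
    funext p
    by_cases hp : p ∈ low P
    · simp [hp, transferFun_low _ _ hp]
    · simp [hp, transferFun_up _ _ hp]
  rw [h]
  have c1 := continuous_b₁ (P := P)
  have c2 := continuous_b₂ (P := P)
  have c3 := continuous_b₃ (P := P)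
  refine Continuous.if (fun p hp => ?_) (by fun_prop) (by fun_prop)
  change p ∈ frontier (low P) at hp
  simp [isClopen_low.frontier_eq] at hp

theorem abs_transferFun_le (φ ψ : C(Lam P, ℝ)) (p : Lam P) :
    |transferFun φ ψ p| ≤ 2 * Real.exp ‖φ‖ * ‖ψ‖ := by
  have key : ∀ q : Lam P, |Real.exp (φ q) * ψ q| ≤ Real.exp ‖φ‖ * ‖ψ‖ := by
    intro q
    rw [abs_mul, Real.abs_exp]
    have h1 : φ q ≤ ‖φ‖ := (le_abs_self _).trans (φ.norm_coe_le_norm q)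
    have h2 : |ψ q| ≤ ‖ψ‖ := ψ.norm_coe_le_norm q
    gcongr
  have hn : 0 ≤ Real.exp ‖φ‖ * ‖ψ‖ := by positivity
  by_cases hp : p ∈ low P
  · rw [transferFun_low _ _ hp]
    refine (abs_add_le _ _).trans ?_
    linarith [key (b₁ p), key (b₃ p)]
  · rw [transferFun_up _ _ hp]
    linarith [key (b₂ p)]

/-- The Ruelle–Perron–Frobenius operator `L_φ`, as a bounded operator on `C(Λ)`. -/
noncomputable def transferOp (φ : C(Lam P, ℝ)) : C(Lam P, ℝ) →L[ℝ] C(Lam P, ℝ) :=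
  LinearMap.mkContinuous
    { toFun := fun ψ => ⟨transferFun φ ψ, continuous_transferFun φ ψ⟩
      map_add' := fun ψ₁ ψ₂ => by
        ext p
        by_cases hp : p ∈ low P
        · simp [transferFun_low _ _ hp]
          ring
        · simp [transferFun_up _ _ hp]
          ring
      map_smul' := fun c ψ => by
        ext p
        by_cases hp : p ∈ low P
        · simp [transferFun_low _ _ hp]
          ring
        · simp [transferFun_up _ _ hp]
          ring }
    (2 * Real.exp ‖φ‖)
    (fun ψ => (ContinuousMap.norm_le _ (by positivity)).2 fun p => abs_transferFun_le φ ψ p)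

theorem transferOp_apply (φ ψ : C(Lam P, ℝ)) (x : Lam P) :
    transferOp φ ψ x = ∑ᶠ y ∈ G P ⁻¹' {x}, Real.exp (φ y) * ψ y := rfl

/-- The spectral radius of a bounded operator on a real Banach space,
`r(T) = limsup ‖T ^ n‖ ^ (1 / n)`. -/
noncomputable def spectralRad {E : Type*} [NormedAddCommGroup E] [NormedSpace ℝ E]
    (T : E →L[ℝ] E) : ℝ :=
  Filter.limsup (fun n : ℕ => ‖T ^ n‖ ^ (1 / (n : ℝ))) Filter.atTop

/-- `μ = L_φ^* η` for the dual of the transfer operator acting on (finite Borel) measures: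
`∫ ψ dμ = ∫ L_φ ψ dη` for every continuous `ψ`. -/
def IsDualTransfer (φ : C(Lam P, ℝ)) (η μ : MeasureTheory.Measure (Lam P)) : Prop :=
  ∀ ψ : C(Lam P, ℝ), ∫ x, ψ x ∂μ = ∫ x, transferOp φ ψ x ∂η

/-- Hölder continuity with some exponent in `(0, 1]`. -/
def IsHolder {X : Type*} [MetricSpace X] (u : X → ℝ) : Prop :=
  ∃ C r : NNReal, 0 < r ∧ r ≤ 1 ∧ HolderWith C r u

end HorseshoeProjection

/-!
In the logit coordinate `log (y / (1 - y))` the map `f` is the translation by `1`, so no inverse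
branch of `G` expands the central direction `y`, and those on the upper plane contract it, by a
factor that tends to `1` only as `y → 1`. The contraction is lost only along the single branch that
stays in the lower plane, and near `y = 1`; a Lyapunov function built from `log (1 - y)` shows that
for every `κ > 1` some moment of the logit derivative has growth rate at most `κ`. On the other
hand `L^n 1` grows at rate at least `ω exp (inf φ)`, the golden mean `ω` being the Perron
eigenvalue of the transition graph of the two planes; by the bound on the variation of `φ` this
exceeds `exp (sup φ)`, the largest weight of a single branch. Interpolating between the moment
bound and the plain growth of `L^n 1` by Hölder's inequality, the derivative decays on average
along the branches of order `n`, relative to `‖L^n 1‖`. The passage from the logit coordinate back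
to `y` degenerates only near `y = 0` and `y = 1`, where a single branch can stay, and one branch is
too light to matter.

Averaged contraction yields Hölder and lower bounds for `L^n u / ‖L^n u‖` uniform in `n`, where `u`
is the Perron vector of the transition graph. The Markov–Kakutani theorem on compact convex sets
then produces both `ν` and `h`.
-/

namespace HorseshoeProjection

/-! ### Weighted sums over branches -/

section MonotoneEnd

variable {E : Type*} [AddCommGroup E] [PartialOrder E] [Module ℝ E]
  {T : Module.End ℝ E}

theorem monotone_end_pow (hT : Monotone T) (n : ℕ) : Monotone (T ^ n) := by
  rw [Module.End.coe_pow]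
  exact hT.iterate n

theorem end_pow_apply_nonneg (hT : Monotone T) {F : E} (hF : 0 ≤ F) (n : ℕ) :
    0 ≤ (T ^ n) F := by
  simpa only [map_zero] using monotone_end_pow hT n hF

theorem end_pow_apply_le_of_apply_le [PosSMulMono ℝ E] (hT : Monotone T) {κ : ℝ} (hκ : 0 ≤ κ)
    {m : E} (hm : T m ≤ κ • m) (n : ℕ) : (T ^ n) m ≤ κ ^ n • m := by
  induction n with
  | zero => simp
  | succ n ih =>
    calc (T ^ (n + 1)) m = (T ^ n) (T m) := by rw [pow_succ, Module.End.mul_apply]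
      _ ≤ (T ^ n) (κ • m) := monotone_end_pow hT n hm
      _ = κ • (T ^ n) m := map_smul _ _ _
      _ ≤ κ • κ ^ n • m := smul_le_smul_of_nonneg_left ih hκ
      _ = κ ^ (n + 1) • m := by rw [smul_smul, pow_succ']

end MonotoneEnd

section BranchSum

variable {ι S : Type*} [Fintype ι]

/-- The operator `F ↦ ∑ i, g i * (F ∘ β i)` summing a function over finitely many branches `β i`
with weights `g i`: the common shape of all the transfer operators below. -/
def branchSum (β : ι → S → S) (g : ι → S → ℝ) : Module.End ℝ (S → ℝ) where
  toFun F s := ∑ i, g i s * F (β i s)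
  map_add' F F' := by
    ext s
    simp only [Pi.add_apply, mul_add, Finset.sum_add_distrib]
  map_smul' c F := by
    ext s
    simp only [Pi.smul_apply, smul_eq_mul, RingHom.id_apply, Finset.mul_sum, mul_left_comm c]

variable {β : ι → S → S} {g g' : ι → S → ℝ}

theorem branchSum_apply (F : S → ℝ) (s : S) : branchSum β g F s = ∑ i, g i s * F (β i s) := rfl

theorem branchSum_mono (hg : 0 ≤ g) : Monotone (branchSum β g) := fun _ _ hF s =>
  Finset.sum_le_sum fun i _ => mul_le_mul_of_nonneg_left (hF (β i s)) (hg i s)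

theorem branchSum_pow_nonneg (hg : 0 ≤ g) {F : S → ℝ} (hF : 0 ≤ F) (n : ℕ) :
    0 ≤ (branchSum β g ^ n) F :=
  end_pow_apply_nonneg (branchSum_mono hg) hF n

theorem branchSum_pow_mono_weight (hg : 0 ≤ g) (hgg' : g ≤ g') {F : S → ℝ} (hF : 0 ≤ F) (n : ℕ) :
    (branchSum β g ^ n) F ≤ (branchSum β g' ^ n) F := by
  induction n with
  | zero => exact le_rfl
  | succ n ih =>
    rw [pow_succ', pow_succ']
    refine (branchSum_mono hg ih).trans fun s => Finset.sum_le_sum fun i _ => ?_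
    exact mul_le_mul_of_nonneg_right (hgg' i s)
      (branchSum_pow_nonneg (hg.trans hgg') hF n (β i s))

theorem branchSum_smul (c : ℝ) : branchSum β (c • g) = c • branchSum β g := by
  ext F s
  simp only [branchSum_apply, LinearMap.smul_apply, Pi.smul_apply, smul_eq_mul, Finset.mul_sum,
    mul_assoc]

theorem mul_branchSum_pow {w : S → ℝ} (hw : ∀ i s, w s * g i s = g' i s * w (β i s))
    (F : S → ℝ) (n : ℕ) :
    w * (branchSum β g ^ n) F = (branchSum β g' ^ n) (w * F) := by
  induction n with
  | zero => rfl
  | succ n ih =>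
    ext s
    rw [pow_succ', pow_succ', Module.End.mul_apply, Module.End.mul_apply, ← ih, Pi.mul_apply,
      branchSum_apply, branchSum_apply, Finset.mul_sum]
    exact Finset.sum_congr rfl fun i _ => by rw [← mul_assoc, hw, Pi.mul_apply, mul_assoc]

theorem branchSum_pow_comp {S' : Type*} {β' : ι → S' → S'} {k : ι → S' → ℝ} {π : S → S'}
    (hπ : ∀ i s, π (β i s) = β' i (π s)) (F : S' → ℝ) (n : ℕ) :
    (branchSum β (fun i => k i ∘ π) ^ n) (F ∘ π) = (branchSum β' k ^ n) F ∘ π := by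
  induction n with
  | zero => rfl
  | succ n ih =>
    ext s
    simp only [pow_succ', Module.End.mul_apply, ih, branchSum_apply, Function.comp_apply, hπ]

theorem sum_rpow_mul_rpow_le {t : ℝ} (ht0 : 0 < t) (ht1 : t < 1) {a b : ι → ℝ} (ha : 0 ≤ a)
    (hb : 0 ≤ b) :
    ∑ i, a i ^ (1 - t) * b i ^ t ≤ (∑ i, a i) ^ (1 - t) * (∑ i, b i) ^ t := by
  have h1t : 1 - t ≠ 0 := (sub_pos.2 ht1).ne'
  have hpq : (1 - t)⁻¹.HolderConjugate t⁻¹ :=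
    Real.HolderConjugate.inv_inv (sub_pos.2 ht1) ht0 (by ring)
  have h := Real.inner_le_Lp_mul_Lq_of_nonneg Finset.univ hpq
    (f := fun i => a i ^ (1 - t)) (g := fun i => b i ^ t)
    (fun i _ => Real.rpow_nonneg (ha i) _) (fun i _ => Real.rpow_nonneg (hb i) _)
  simpa only [Real.rpow_rpow_inv (ha _) h1t, Real.rpow_rpow_inv (hb _) ht0.ne', one_div,
    inv_inv] using h

theorem branchSum_pow_rpow_le {t : ℝ} (ht0 : 0 < t) (ht1 : t < 1) (hg : 0 ≤ g) (hg' : 0 ≤ g')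
    {F : S → ℝ} (hF : 0 ≤ F) (n : ℕ) (s : S) :
    (branchSum β (fun i s => g i s ^ (1 - t) * g' i s ^ t) ^ n) F s
      ≤ (branchSum β g ^ n) F s ^ (1 - t) * (branchSum β g' ^ n) F s ^ t := by
  induction n generalizing s with
  | zero =>
    simp only [pow_zero, Module.End.one_apply]
    rw [← Real.rpow_add_of_nonneg (hF s) (sub_pos.2 ht1).le ht0.le, sub_add_cancel, Real.rpow_one]
  | succ n ih =>
    have hn (i) (s) := branchSum_pow_nonneg (β := β) hg hF n (β i s)
    have hn' (i) (s) := branchSum_pow_nonneg (β := β) hg' hF n (β i s)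
    simp only [pow_succ', Module.End.mul_apply, branchSum_apply]
    refine le_trans (Finset.sum_le_sum fun i _ => ?_) (sum_rpow_mul_rpow_le ht0 ht1
      (fun i => mul_nonneg (hg i s) (hn i s)) (fun i => mul_nonneg (hg' i s) (hn' i s)))
    rw [Real.mul_rpow (hg i s) (hn i s), Real.mul_rpow (hg' i s) (hn' i s), mul_mul_mul_comm]
    exact mul_le_mul_of_nonneg_left (ih (β i s))
      (mul_nonneg (Real.rpow_nonneg (hg i s) _) (Real.rpow_nonneg (hg' i s) _))

end BranchSum

/-! ### Quasi-multiplicative operators -/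

section QuasiAdditive

open Filter Topology

variable {u : ℕ → ℝ} {D : ℝ}

theorem bddBelow_div_of_subadditive_sub (hu : Subadditive u)
    (hDu : Subadditive fun n => D - u n) : BddBelow (Set.range fun n : ℕ => u n / n) := by
  refine ⟨min 0 (u 1 - D), ?_⟩
  rintro _ ⟨n, rfl⟩
  rcases n.eq_zero_or_pos with rfl | hn
  · simp
  have h0 : u (0 + 0) ≤ u 0 + u 0 := hu 0 0
  have h1 := hDu.apply_mul_add_le n 1 0
  simp only [mul_one, add_zero] at h0 h1
  refine (min_le_right _ _).trans ((le_div_iff₀ (Nat.cast_pos.2 hn)).2 ?_)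
  linarith

theorem exists_tendsto_div_of_subadditive_sub (hu : Subadditive u)
    (hDu : Subadditive fun n => D - u n) :
    ∃ L, Tendsto (fun n : ℕ => u n / n) atTop (𝓝 L) ∧ ∀ n : ℕ, n * L ≤ u n ∧ u n ≤ n * L + D := by
  have hbdd := bddBelow_div_of_subadditive_sub hu hDu
  have hbddD := bddBelow_div_of_subadditive_sub (D := D) hDu (by simpa only [sub_sub_cancel])
  have hlim : hDu.lim = -hu.lim := by
    refine tendsto_nhds_unique (hDu.tendsto_lim hbddD) ?_
    simpa only [sub_div, zero_sub] using
      (tendsto_const_div_atTop_nhds_zero_nat D).sub (hu.tendsto_lim hbdd)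
  refine ⟨hu.lim, hu.tendsto_lim hbdd, fun n => ?_⟩
  rcases n.eq_zero_or_pos with rfl | hn
  · have h0 := hu 0 0
    have hD0 := hDu 0 0
    simp only [add_zero] at h0 hD0
    constructor <;> simp only [Nat.cast_zero] <;> linarith
  · have hn' : (0 : ℝ) < n := Nat.cast_pos.2 hn
    have h := (le_div_iff₀ hn').1 (hu.lim_le_div hbdd hn.ne')
    have hD := (le_div_iff₀ hn').1 (hDu.lim_le_div hbddD hn.ne')
    rw [hlim] at hD
    constructor <;> linarith

end QuasiAdditive

section QuasiMultiplicative

open Filter Topology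

variable {E : Type*} [NormedAddCommGroup E] [NormedSpace ℝ E] {T : E →L[ℝ] E} {d : ℝ}

/-- A bounded operator is quasi-multiplicative with constant `d > 0` if the norms of its powers are
multiplicative up to the factor `d`. The spectral radius of such an operator is positive and the
norms of its powers grow exactly exponentially. -/
structure IsQuasiMultiplicative (T : E →L[ℝ] E) (d : ℝ) : Prop where
  pos : 0 < d
  norm_pow_pos (n : ℕ) : 0 < ‖T ^ n‖
  mul_norm_pow_le (m n : ℕ) : d * (‖T ^ m‖ * ‖T ^ n‖) ≤ ‖T ^ (m + n)‖

theorem IsQuasiMultiplicative.exists_log_norm_pow_bounds (hT : IsQuasiMultiplicative T d) :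
    ∃ L, Tendsto (fun n : ℕ => Real.log ‖T ^ n‖ / n) atTop (𝓝 L) ∧
      ∀ n : ℕ, n * L ≤ Real.log ‖T ^ n‖ ∧ Real.log ‖T ^ n‖ ≤ n * L + -Real.log d := by
  refine exists_tendsto_div_of_subadditive_sub (fun m n => ?_) (fun m n => ?_)
  · rw [← Real.log_mul (hT.norm_pow_pos m).ne' (hT.norm_pow_pos n).ne', pow_add]
    exact Real.log_le_log (pow_add T m n ▸ hT.norm_pow_pos (m + n)) (norm_mul_le _ _)
  · have hmn := mul_pos (hT.norm_pow_pos m) (hT.norm_pow_pos n)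
    have h := Real.log_le_log (mul_pos hT.pos hmn) (hT.mul_norm_pow_le m n)
    rw [Real.log_mul hT.pos.ne' hmn.ne',
      Real.log_mul (hT.norm_pow_pos m).ne' (hT.norm_pow_pos n).ne'] at h
    linarith

theorem IsQuasiMultiplicative.spectralRad_pos_and_norm_pow_bounds
    (hT : IsQuasiMultiplicative T d) :
    0 < spectralRad T ∧ ∀ n, spectralRad T ^ n ≤ ‖T ^ n‖ ∧ d * ‖T ^ n‖ ≤ spectralRad T ^ n := by
  obtain ⟨L, hlim, hL⟩ := hT.exists_log_norm_pow_bounds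
  have hrad : spectralRad T = Real.exp L := by
    refine Tendsto.limsup_eq (((Real.continuous_exp.tendsto L).comp hlim).congr fun n => ?_)
    rw [Function.comp_apply, Real.rpow_def_of_pos (hT.norm_pow_pos n), mul_one_div]
  refine ⟨hrad ▸ Real.exp_pos L, fun n => ?_⟩
  rw [hrad, ← Real.exp_nat_mul]
  refine ⟨(Real.le_log_iff_exp_le (hT.norm_pow_pos n)).1 (hL n).1, ?_⟩
  rw [← Real.log_le_iff_le_exp (mul_pos hT.pos (hT.norm_pow_pos n)),
    Real.log_mul hT.pos.ne' (hT.norm_pow_pos n).ne']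
  linarith [(hL n).2]

end QuasiMultiplicative

/-! ### Fixed points with compact convex orbits -/

section FixedPoint

open Filter Topology

theorem birkhoffAverage_mem_of_convex {α E : Type*} [AddCommGroup E] [Module ℝ E] {K : Set E}
    (hK : Convex ℝ K) {f : α → α} {g : α → E} {x : α} (hx : ∀ n, g (f^[n] x) ∈ K) {n : ℕ}
    (hn : n ≠ 0) : birkhoffAverage ℝ f g n x ∈ K := by
  rw [birkhoffAverage, birkhoffSum, Finset.smul_sum]
  refine hK.sum_mem (fun _ _ => by positivity) ?_ fun k _ => hx k
  rw [Finset.sum_const, Finset.card_range, nsmul_eq_mul, mul_inv_cancel₀ (Nat.cast_ne_zero.2 hn)]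

/-- The Markov–Kakutani fixed point theorem for a single map, requiring only one orbit to stay in
the compact convex set. -/
theorem exists_fixedPoint_of_orbit_mem {E : Type*} [AddCommGroup E] [Module ℝ E]
    [TopologicalSpace E] [IsTopologicalAddGroup E] [ContinuousSMul ℝ E] [T2Space E]
    (T : E →L[ℝ] E) {K : Set E} (hK : IsCompact K) (hconv : Convex ℝ K) {x : E}
    (hx : ∀ n, T^[n] x ∈ K) : ∃ y ∈ K, T y = y := by
  have hmem : ∀ᶠ n in hyperfilter ℕ, birkhoffAverage ℝ T id n x ∈ K :=
    Nat.hyperfilter_le_atTop ((eventually_ne_atTop 0).mono fun n hn =>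
      birkhoffAverage_mem_of_convex hconv (by exact hx) hn)
  obtain ⟨y, hyK, hy⟩ := hK.ultrafilter_le_nhds
    ((hyperfilter ℕ).map (birkhoffAverage ℝ T id · x)) (le_principal_iff.2 hmem)
  refine ⟨y, hyK, sub_eq_zero.1 (tendsto_nhds_unique (f := fun n =>
    T (birkhoffAverage ℝ T id n x) - birkhoffAverage ℝ T id n x)
    (((T.continuous.tendsto y).comp hy).sub hy) ?_)⟩
  have hbdd := (hK.isVonNBounded (𝕜 := ℝ)).sub (hK.isVonNBounded (𝕜 := ℝ))
  refine Tendsto.mono_left ?_ Nat.hyperfilter_le_atTop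
  refine (hbdd.smul_tendsto_zero (.of_forall fun n => Set.sub_mem_sub (hx n) (hx 0))
    tendsto_inv_atTop_nhds_zero_nat).congr fun n => ?_
  have hcomm : T (birkhoffAverage ℝ T id n x) = birkhoffAverage ℝ T id n (T x) := by
    simp only [birkhoffAverage, birkhoffSum, map_smul, map_sum, id,
      ← Function.iterate_succ_apply, ← Function.iterate_succ_apply']
  rw [hcomm, birkhoffAverage_apply_sub_birkhoffAverage]
  rfl

end FixedPoint

section HolderBox

variable {X : Type*} [MetricSpace X] {a b D r : ℝ}

theorem holderWith_of_abs_sub_le {u : X → ℝ} (hD : 0 ≤ D) (hr : 0 ≤ r)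
    (h : ∀ x y, |u x - u y| ≤ D * dist x y ^ r) : HolderWith D.toNNReal r.toNNReal u := by
  intro x y
  rw [edist_nndist, edist_nndist, ← ENNReal.coe_rpow_of_nonneg _ (NNReal.coe_nonneg _),
    ← ENNReal.coe_mul, ENNReal.coe_le_coe, ← NNReal.coe_le_coe]
  push_cast
  rw [Real.coe_toNNReal _ hD, Real.coe_toNNReal _ hr, Real.dist_eq]
  exact h x y

theorem isHolder_of_abs_sub_le {u : X → ℝ} (hD : 0 ≤ D) (hr0 : 0 < r) (hr1 : r ≤ 1)
    (h : ∀ x y, |u x - u y| ≤ D * dist x y ^ r) : IsHolder u :=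
  ⟨_, _, Real.toNNReal_pos.2 hr0, Real.toNNReal_le_one.2 hr1,
    holderWith_of_abs_sub_le hD hr0.le h⟩

variable (X a b D r) in
/-- The functions with values in `[a, b]` that are `r`-Hölder with constant `D`, as a subset of the
product space; it is compact in the uniform topology as well. -/
def holderBox : Set (X → ℝ) :=
  {u | (∀ x, u x ∈ Set.Icc a b) ∧ ∀ x y, |u x - u y| ≤ D * dist x y ^ r}

theorem convex_holderBox : Convex ℝ (holderBox X a b D r) := by
  rintro u ⟨hu, hu'⟩ v ⟨hv, hv'⟩ s t hs ht hst
  refine ⟨fun x => convex_Icc a b (hu x) (hv x) hs ht hst, fun x y => ?_⟩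
  calc |(s • u + t • v) x - (s • u + t • v) y|
      = |s * (u x - u y) + t * (v x - v y)| := by
        simp only [Pi.add_apply, Pi.smul_apply, smul_eq_mul]
        ring_nf
    _ ≤ s * |u x - u y| + t * |v x - v y| :=
        (abs_add_le _ _).trans_eq (by rw [abs_mul, abs_mul, abs_of_nonneg hs, abs_of_nonneg ht])
    _ ≤ s * (D * dist x y ^ r) + t * (D * dist x y ^ r) := by gcongr <;> solve_by_elim
    _ = D * dist x y ^ r := by rw [← add_mul, hst, one_mul]

theorem isCompact_holderBox : IsCompact (holderBox X a b D r) := by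
  refine (isCompact_univ_pi fun _ => isCompact_Icc (a := a) (b := b)).of_isClosed_subset ?_
    fun u hu x _ => hu.1 x
  simp only [holderBox, Set.ofPred_and, Set.ofPred_forall]
  refine (isClosed_iInter fun x => isClosed_Icc.preimage (continuous_apply x)).inter
    (isClosed_iInter fun x => isClosed_iInter fun y => isClosed_le ?_ continuous_const)
  fun_prop

theorem isCompact_coe_preimage_holderBox (hD : 0 ≤ D) (hr : 0 < r) :
    IsCompact ((↑) ⁻¹' holderBox X a b D r : Set C(X, ℝ)) := by
  refine ArzelaAscoli.isCompact_of_equicontinuous _ ?_ fun x => ?_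
  · convert! isCompact_holderBox (X := X) (a := a) (b := b) (D := D) (r := r) using 1
    refine Set.image_preimage_eq_of_subset fun u hu => ?_
    exact ⟨⟨u, (holderWith_of_abs_sub_le hD hr.le hu.2).continuous (Real.toNNReal_pos.2 hr)⟩, rfl⟩
  · refine Metric.equicontinuousAt_of_continuity_modulus (fun y => D * dist x y ^ r) ?_ _
      (.of_forall fun y u => u.2.2 x y)
    have hcont : Continuous fun y : X => D * dist x y ^ r :=
      continuous_const.mul ((continuous_const.dist continuous_id).rpow_const fun _ => .inr hr.le)
    simpa only [dist_self, Real.zero_rpow hr.ne', mul_zero] using hcont.tendsto x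

theorem exists_fixedPoint_mem_holderBox [CompactSpace X] (hD : 0 ≤ D) (hr : 0 < r)
    (T : C(X, ℝ) →L[ℝ] C(X, ℝ)) {u : C(X, ℝ)} (hu : ∀ n, ⇑((T ^ n) u) ∈ holderBox X a b D r) :
    ∃ h : C(X, ℝ), ⇑h ∈ holderBox X a b D r ∧ T h = h :=
  exists_fixedPoint_of_orbit_mem T (isCompact_coe_preimage_holderBox hD hr)
    (convex_holderBox.linear_preimage (ContinuousMap.coeFnLinearMap ℝ)) fun n => by
      rw [← FunLike.coe_pow_eq_iterate]
      exact hu n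

end HolderBox

/-! ### A Perron–Frobenius theorem for positive operators -/

section PositiveFunctional

open MeasureTheory CompactlySupported

variable {X : Type*} [TopologicalSpace X]

variable (X) in
/-- The positive functionals on `C(X)` whose value at `1` lies in `[a, b]`. -/
def positiveFunctionals (a b : ℝ) : Set (WeakDual ℝ C(X, ℝ)) :=
  {S | Monotone S ∧ S 1 ∈ Set.Icc a b}

theorem convex_positiveFunctionals (a b : ℝ) : Convex ℝ (positiveFunctionals X a b) := by
  rintro S ⟨hS, hS1⟩ S' ⟨hS', hS1'⟩ s t hs ht hst
  exact ⟨(hS.const_mul hs).add (hS'.const_mul ht), convex_Icc a b hS1 hS1' hs ht hst⟩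

variable [CompactSpace X]

theorem abs_apply_le_norm_mul {S : C(X, ℝ) →ₗ[ℝ] ℝ} (hS : Monotone S) (ψ : C(X, ℝ)) :
    |S ψ| ≤ ‖ψ‖ * S 1 := by
  have hle : ψ ≤ ‖ψ‖ • (1 : C(X, ℝ)) := fun x => by
    simpa using (le_abs_self _).trans (ψ.norm_coe_le_norm x)
  have hge : -(‖ψ‖ • (1 : C(X, ℝ))) ≤ ψ := fun x => by
    simpa using (abs_le.1 (ψ.norm_coe_le_norm x)).1
  have h₁ := hS hle
  have h₂ := hS hge
  rw [map_smul, smul_eq_mul] at h₁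
  rw [map_neg, map_smul, smul_eq_mul] at h₂
  exact abs_le.2 ⟨h₂, h₁⟩

theorem exists_isProbabilityMeasure_integral_eq [T2Space X] [MeasurableSpace X] [BorelSpace X]
    {S : C(X, ℝ) →ₗ[ℝ] ℝ} (hS : Monotone S) (hS1 : 0 < S 1) :
    ∃ ν : Measure X, IsProbabilityMeasure ν ∧ ∀ ψ : C(X, ℝ), ∫ x, ψ x ∂ν = (S 1)⁻¹ * S ψ := by
  let incl : C_c(X, ℝ) →ₗ[ℝ] C(X, ℝ) :=
    { toFun := fun g => g.toContinuousMap
      map_add' := fun _ _ => rfl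
      map_smul' := fun _ _ => rfl }
  let S' : C_c(X, ℝ) →ₚ[ℝ] ℝ := PositiveLinearMap.mk₀ ((S 1)⁻¹ • S.comp incl) fun g hg =>
    mul_nonneg (inv_nonneg.2 hS1.le) (map_zero S ▸ hS hg)
  have hint (ψ : C(X, ℝ)) : ∫ x, ψ x ∂(RealRMK.rieszMeasure S') = (S 1)⁻¹ * S ψ :=
    RealRMK.integral_rieszMeasure S' (CompactlySupportedContinuousMap.continuousMapEquiv ψ)
  refine ⟨RealRMK.rieszMeasure S', ⟨?_⟩, hint⟩
  have h1 := hint 1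
  simp only [ContinuousMap.one_apply, integral_const, smul_eq_mul, mul_one,
    inv_mul_cancel₀ hS1.ne'] at h1
  exact (ENNReal.toReal_eq_one_iff _).1 h1

theorem isCompact_positiveFunctionals (a b : ℝ) : IsCompact (positiveFunctionals X a b) := by
  refine (WeakDual.isCompact_closedBall (𝕜 := ℝ) 0 (max b 0)).of_isClosed_subset ?_ ?_
  · simp only [positiveFunctionals, Monotone, Set.ofPred_and, Set.ofPred_forall]
    refine (isClosed_iInter fun ψ => isClosed_iInter fun ψ' => isClosed_iInter fun _ =>
      isClosed_le (WeakDual.eval_continuous ψ) (WeakDual.eval_continuous ψ')).inter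
      (isClosed_Icc.preimage (WeakDual.eval_continuous 1))
  · rintro S ⟨hS, hS1⟩
    rw [Set.mem_preimage, mem_closedBall_zero_iff]
    refine ContinuousLinearMap.opNorm_le_bound _ (le_max_right _ _) fun ψ => ?_
    calc |S ψ| ≤ ‖ψ‖ * S 1 :=
          abs_apply_le_norm_mul (S := (WeakDual.toStrongDual S).toLinearMap) hS ψ
      _ ≤ ‖ψ‖ * max b 0 := by gcongr; exact hS1.2.trans (le_max_left _ _)
      _ = max b 0 * ‖ψ‖ := mul_comm _ _

/-- The transpose of a bounded operator, acting on the dual with its weak-* topology. -/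
noncomputable def weakTranspose {E : Type*} [NormedAddCommGroup E] [NormedSpace ℝ E]
    (T : E →L[ℝ] E) : WeakDual ℝ E →L[ℝ] WeakDual ℝ E where
  toFun S := StrongDual.toWeakDual ((WeakDual.toStrongDual S).comp T)
  map_add' _ _ := rfl
  map_smul' _ _ := rfl
  cont := WeakDual.continuous_of_continuous_eval fun ψ => WeakDual.eval_continuous (T ψ)

theorem weakTranspose_iterate_apply {E : Type*} [NormedAddCommGroup E] [NormedSpace ℝ E]
    (T : E →L[ℝ] E) (S : WeakDual ℝ E) (n : ℕ) (x : E) :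
    (weakTranspose T)^[n] S x = S ((T ^ n) x) := by
  induction n generalizing x with
  | zero => rfl
  | succ n ih =>
    rw [Function.iterate_succ_apply']
    exact (ih (T x)).trans (by rw [pow_succ, mul_apply_eq_comp])

theorem exists_isProbabilityMeasure_integral_apply_eq [T2Space X] [MeasurableSpace X]
    [BorelSpace X] {T : C(X, ℝ) →L[ℝ] C(X, ℝ)} (hT : Monotone T) {a b : ℝ} (ha : 0 < a) (x : X)
    (hx : ∀ n, (T ^ n) 1 x ∈ Set.Icc a b) :
    ∃ ν : Measure X, IsProbabilityMeasure ν ∧ ∀ ψ : C(X, ℝ), ∫ y, T ψ y ∂ν = ∫ y, ψ y ∂ν := by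
  let dirac : WeakDual ℝ C(X, ℝ) := StrongDual.toWeakDual (ContinuousMap.evalCLM ℝ x)
  obtain ⟨S, ⟨hS, hS1⟩, hfix⟩ := exists_fixedPoint_of_orbit_mem (weakTranspose T)
    (isCompact_positiveFunctionals a b) (convex_positiveFunctionals a b) (x := dirac) fun n => by
      refine ⟨fun ψ ψ' h => ?_, ?_⟩
      · simp only [weakTranspose_iterate_apply, FunLike.coe_pow_eq_iterate]
        exact hT.iterate n h x
      · rw [weakTranspose_iterate_apply]
        exact hx n
  obtain ⟨ν, hν, hint⟩ := exists_isProbabilityMeasure_integral_eq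
    (S := (WeakDual.toStrongDual S).toLinearMap) hS (ha.trans_le hS1.1)
  refine ⟨ν, hν, fun ψ => ?_⟩
  rw [hint, hint]
  exact congrArg _ (DFunLike.congr_fun hfix ψ)

end PositiveFunctional

section PerronFrobenius

variable {X : Type*} [TopologicalSpace X] [CompactSpace X] {T : C(X, ℝ) →L[ℝ] C(X, ℝ)}
  {u : C(X, ℝ)} {c : ℝ}

theorem monotone_clm_pow (hT : Monotone T) (n : ℕ) : Monotone ⇑(T ^ n) := by
  rw [FunLike.coe_pow_eq_iterate]
  exact hT.iterate n

theorem le_norm_smul_one (ψ : C(X, ℝ)) : ψ ≤ ‖ψ‖ • 1 := fun x => by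
  simpa using (le_abs_self _).trans (ψ.norm_coe_le_norm x)

theorem norm_le_norm_of_nonneg_of_le {ψ ψ' : C(X, ℝ)} (hψ : 0 ≤ ψ) (hle : ψ ≤ ψ') :
    ‖ψ‖ ≤ ‖ψ'‖ :=
  (ContinuousMap.norm_le _ (norm_nonneg _)).2 fun x =>
    (Real.norm_of_nonneg (hψ x)).trans_le
      ((hle x).trans ((le_abs_self _).trans (ψ'.norm_coe_le_norm x)))

theorem norm_le_norm_apply_of_one_le (hT : Monotone T) (hu : 1 ≤ u) : ‖T‖ ≤ ‖T u‖ := by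
  refine T.opNorm_le_bound (norm_nonneg _) fun ψ =>
    (ContinuousMap.norm_le _ (by positivity)).2 fun x => ?_
  have hx : Monotone ((ContinuousMap.evalCLM ℝ x).toLinearMap ∘ₗ T.toLinearMap) :=
    fun _ _ h => hT h x
  calc ‖T ψ x‖ ≤ ‖ψ‖ * T 1 x := abs_apply_le_norm_mul hx ψ
    _ ≤ ‖ψ‖ * ‖T u‖ := by
      gcongr
      exact (hT hu x).trans ((le_abs_self _).trans ((T u).norm_coe_le_norm x))
    _ = ‖T u‖ * ‖ψ‖ := mul_comm _ _

/-- The orbit of `u` under `T` is uniformly balanced: each `T ^ n u` is nonzero and its infimum is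
at least the fixed proportion `c` of its norm. -/
structure IsBalanced (T : C(X, ℝ) →L[ℝ] C(X, ℝ)) (u : C(X, ℝ)) (c : ℝ) : Prop where
  pos : 0 < c
  one_le : 1 ≤ u
  norm_pos (n : ℕ) : 0 < ‖(T ^ n) u‖
  mul_norm_le (n : ℕ) (x : X) : c * ‖(T ^ n) u‖ ≤ (T ^ n) u x

theorem IsBalanced.norm_u_pos (h : IsBalanced T u c) : 0 < ‖u‖ := h.norm_pos 0

theorem IsBalanced.mul_norm_mul_norm_le (hT : Monotone T) (h : IsBalanced T u c) (m n : ℕ) :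
    c / ‖u‖ * (‖(T ^ m) u‖ * ‖(T ^ n) u‖) ≤ ‖(T ^ (m + n)) u‖ := by
  have hu := h.norm_u_pos
  have hc := h.pos
  have hle : (c * ‖(T ^ n) u‖ / ‖u‖) • u ≤ (T ^ n) u := fun x => by
    refine le_trans ?_ (h.mul_norm_le n x)
    change c * ‖(T ^ n) u‖ / ‖u‖ * u x ≤ c * ‖(T ^ n) u‖
    rw [div_mul_eq_mul_div, div_le_iff₀ hu]
    gcongr
    exact (le_abs_self _).trans (u.norm_coe_le_norm x)
  have hpow : ((c * ‖(T ^ n) u‖ / ‖u‖)) • (T ^ m) u ≤ (T ^ (m + n)) u := by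
    rw [pow_add, mul_apply_eq_comp, ← map_smul]
    exact monotone_clm_pow hT m hle
  have hnn : 0 ≤ (T ^ m) u := map_zero (T ^ m) ▸
    monotone_clm_pow hT m (zero_le_one.trans h.one_le)
  calc c / ‖u‖ * (‖(T ^ m) u‖ * ‖(T ^ n) u‖) = ‖(c * ‖(T ^ n) u‖ / ‖u‖) • (T ^ m) u‖ := by
        rw [norm_smul, Real.norm_of_nonneg (by positivity)]
        ring
    _ ≤ ‖(T ^ (m + n)) u‖ :=
        norm_le_norm_of_nonneg_of_le (smul_nonneg (by positivity) hnn) hpow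

theorem IsBalanced.isQuasiMultiplicative (hT : Monotone T) (h : IsBalanced T u c) :
    IsQuasiMultiplicative T (c / ‖u‖ ^ 2) := by
  have hu := h.norm_u_pos
  have hc := h.pos
  have hle (n : ℕ) : ‖T ^ n‖ ≤ ‖(T ^ n) u‖ :=
    norm_le_norm_apply_of_one_le (monotone_clm_pow hT n) h.one_le
  refine ⟨div_pos hc (pow_pos hu 2), fun n => ?_, fun m n => ?_⟩
  · exact pos_of_mul_pos_left ((h.norm_pos n).trans_le ((T ^ n).le_opNorm u)) hu.le
  · calc c / ‖u‖ ^ 2 * (‖T ^ m‖ * ‖T ^ n‖) ≤ c / ‖u‖ ^ 2 * (‖(T ^ m) u‖ * ‖(T ^ n) u‖) := by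
          gcongr <;> exact hle _
      _ = c / ‖u‖ * (‖(T ^ m) u‖ * ‖(T ^ n) u‖) / ‖u‖ := by field_simp
      _ ≤ ‖(T ^ (m + n)) u‖ / ‖u‖ := by
          gcongr
          exact h.mul_norm_mul_norm_le hT m n
      _ ≤ ‖T ^ (m + n)‖ := (div_le_iff₀ hu).2 ((T ^ (m + n)).le_opNorm u)

theorem IsBalanced.norm_pow_apply_bounds (hT : Monotone T) (h : IsBalanced T u c) (n : ℕ) :
    spectralRad T ^ n ≤ ‖(T ^ n) u‖ ∧ ‖(T ^ n) u‖ ≤ ‖u‖ ^ 3 / c * spectralRad T ^ n := by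
  have hu := h.norm_u_pos
  have hc := h.pos
  obtain ⟨-, hbounds⟩ := (h.isQuasiMultiplicative hT).spectralRad_pos_and_norm_pow_bounds
  constructor
  · exact (hbounds n).1.trans
      (norm_le_norm_apply_of_one_le (monotone_clm_pow hT n) h.one_le)
  · calc ‖(T ^ n) u‖ ≤ ‖T ^ n‖ * ‖u‖ := (T ^ n).le_opNorm u
      _ = ‖u‖ ^ 3 / c * (c / ‖u‖ ^ 2 * ‖T ^ n‖) := by field_simp
      _ ≤ ‖u‖ ^ 3 / c * spectralRad T ^ n := by
        gcongr
        exact (hbounds n).2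

theorem inv_smul_clm_pow_apply (l : ℝ) (n : ℕ) (ψ : C(X, ℝ)) (x : X) :
    ((l⁻¹ • T) ^ n) ψ x = (T ^ n) ψ x / l ^ n := by
  induction n generalizing ψ with
  | zero => simp
  | succ n ih =>
    rw [pow_succ, mul_apply_eq_comp, ih, smul_apply, map_smul, ContinuousMap.smul_apply,
      smul_eq_mul, pow_succ, mul_apply_eq_comp, pow_succ]
    field_simp

theorem IsBalanced.normalized_pow_apply_mem_Icc (hT : Monotone T) (h : IsBalanced T u c) (n : ℕ)
    (x : X) : (((spectralRad T)⁻¹ • T) ^ n) u x ∈ Set.Icc c (‖u‖ ^ 3 / c) := by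
  have hl := (h.isQuasiMultiplicative hT).spectralRad_pos_and_norm_pow_bounds.1
  obtain ⟨hlow, hup⟩ := h.norm_pow_apply_bounds hT n
  rw [inv_smul_clm_pow_apply]
  constructor
  · rw [le_div_iff₀ (pow_pos hl n)]
    exact (mul_le_mul_of_nonneg_left hlow h.pos.le).trans (h.mul_norm_le n x)
  · rw [div_le_iff₀ (pow_pos hl n)]
    exact ((le_abs_self _).trans (((T ^ n) u).norm_coe_le_norm x)).trans hup

theorem IsBalanced.normalized_pow_one_mem_Icc (hT : Monotone T) (h : IsBalanced T u c) (n : ℕ)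
    (x : X) : (((spectralRad T)⁻¹ • T) ^ n) 1 x ∈ Set.Icc (c / ‖u‖) (‖u‖ ^ 3 / c) := by
  have hl := (h.isQuasiMultiplicative hT).spectralRad_pos_and_norm_pow_bounds.1
  have hmono : Monotone ⇑(((spectralRad T)⁻¹ • T) ^ n) :=
    monotone_clm_pow (fun _ _ hψ => smul_le_smul_of_nonneg_left (hT hψ) (inv_nonneg.2 hl.le)) n
  obtain ⟨hlow, hup⟩ := h.normalized_pow_apply_mem_Icc hT n x
  refine ⟨(div_le_iff₀' h.norm_u_pos).2 (hlow.trans ?_), (hmono h.one_le x).trans hup⟩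
  have hle := hmono (le_norm_smul_one u) x
  rwa [map_smul] at hle

theorem IsBalanced.exists_eigenmeasure [T2Space X] [MeasurableSpace X] [BorelSpace X] [Nonempty X]
    (hT : Monotone T) (h : IsBalanced T u c) :
    ∃ ν : MeasureTheory.Measure X, MeasureTheory.IsProbabilityMeasure ν ∧
      ∀ ψ : C(X, ℝ), ∫ x, T ψ x ∂ν = spectralRad T * ∫ x, ψ x ∂ν := by
  have hl := (h.isQuasiMultiplicative hT).spectralRad_pos_and_norm_pow_bounds.1
  obtain ⟨ν, hν, hint⟩ := exists_isProbabilityMeasure_integral_apply_eq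
    (T := (spectralRad T)⁻¹ • T)
    (fun _ _ hψ => smul_le_smul_of_nonneg_left (hT hψ) (inv_nonneg.2 hl.le))
    (div_pos h.pos h.norm_u_pos) (Classical.arbitrary X) (h.normalized_pow_one_mem_Icc hT · _)
  refine ⟨ν, hν, fun ψ => ?_⟩
  rw [← hint ψ]
  simp only [smul_apply, ContinuousMap.smul_apply, smul_eq_mul,
    MeasureTheory.integral_const_mul, mul_inv_cancel_left₀ hl.ne']

theorem IsBalanced.exists_eigenfunction {X : Type*} [MetricSpace X] [CompactSpace X]
    {T : C(X, ℝ) →L[ℝ] C(X, ℝ)} {u : C(X, ℝ)} {c D r : ℝ} (hT : Monotone T)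
    (h : IsBalanced T u c) (hD : 0 ≤ D) (hr0 : 0 < r) (hr1 : r ≤ 1)
    (hhol : ∀ n x y, |(T ^ n) u x - (T ^ n) u y| ≤ D * ‖(T ^ n) u‖ * dist x y ^ r) :
    ∃ v : C(X, ℝ), (∀ x, 0 < v x) ∧ IsHolder v ∧ T v = spectralRad T • v := by
  have hc := h.pos
  have hl := (h.isQuasiMultiplicative hT).spectralRad_pos_and_norm_pow_bounds.1
  have hD' : 0 ≤ D * (‖u‖ ^ 3 / c) := by positivity
  obtain ⟨v, ⟨hv, hv'⟩, hfix⟩ := exists_fixedPoint_mem_holderBox hD' hr0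
    ((spectralRad T)⁻¹ • T) (u := u) fun n =>
      ⟨h.normalized_pow_apply_mem_Icc hT n, fun x y => by
        rw [inv_smul_clm_pow_apply, inv_smul_clm_pow_apply, ← sub_div, abs_div,
          abs_of_pos (pow_pos hl n), div_le_iff₀ (pow_pos hl n)]
        calc |(T ^ n) u x - (T ^ n) u y| ≤ D * ‖(T ^ n) u‖ * dist x y ^ r := hhol n x y
          _ ≤ D * (‖u‖ ^ 3 / c * spectralRad T ^ n) * dist x y ^ r := by
            gcongr
            exact (h.norm_pow_apply_bounds hT n).2
          _ = D * (‖u‖ ^ 3 / c) * dist x y ^ r * spectralRad T ^ n := by ring⟩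
  refine ⟨v, fun x => hc.trans_le (hv x).1, isHolder_of_abs_sub_le hD' hr0 hr1 hv', ?_⟩
  rwa [smul_apply, inv_smul_eq_iff₀ hl.ne'] at hfix

end PerronFrobenius

/-! ### The inverse branches -/

variable {P : Params}

open Classical in
/-- The inverse branches of `G`, indexed uniformly by `Bool`: `b₁` and `b₃` on the lower plane,
and `b₂` counted twice on the upper plane. -/
noncomputable def branch (i : Bool) (p : Lam P) : Lam P :=
  if p ∈ low P then (if i then b₁ p else b₃ p) else b₂ p

open Classical in
/-- The weight compensating for the double count of `b₂` in `branch`. -/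
noncomputable def branchMult (p : Lam P) : ℝ := if p ∈ low P then 1 else 1 / 2

/-- The weights for which `branchSum branch` is the transfer operator. -/
noncomputable def branchWeight (φ : C(Lam P, ℝ)) (i : Bool) (p : Lam P) : ℝ :=
  branchMult p * Real.exp (φ (branch i p))

open Classical in
/-- The modulus of the derivative of the inverse branches in the central direction `y`. -/
noncomputable def centralDeriv (p : Lam P) : ℝ :=
  if p ∈ low P then Real.exp 1 / (1 + (Real.exp 1 - 1) * p.1.2.1) ^ 2 else P.σ

open Classical in
/-- The modulus of the derivative of the inverse branches in the logit coordinate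
`log (y / (1 - y))`, in which `f` is the translation by `1`. -/
noncomputable def logitDeriv (p : Lam P) : ℝ :=
  if p ∈ low P then 1 else p.1.2.1 / (1 - P.σ * (1 - p.1.2.1))

/-- The density `y (1 - y)` comparing the logit coordinate `log (y / (1 - y))` to `y`. -/
def logitDensity (p : Lam P) : ℝ := p.1.2.1 * (1 - p.1.2.1)

theorem one_lt_exp_one : 1 < Real.exp 1 := by simp

theorem one_sub_f {y : ℝ} (hy : y ∈ Set.Icc (0 : ℝ) 1) :
    1 - f y = (1 - y) / (1 + (Real.exp 1 - 1) * y) := by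
  have h := den_f_pos hy
  rw [f_eq hy.1, eq_div_iff h.ne', sub_mul, div_mul_cancel₀ _ h.ne']
  ring

theorem le_f {y : ℝ} (hy : y ∈ Set.Icc (0 : ℝ) 1) : y ≤ f y := by
  have he := one_lt_exp_one
  rw [f_eq hy.1, le_div_iff₀ (den_f_pos hy)]
  nlinarith [mul_nonneg (mul_nonneg hy.1 (sub_nonneg.2 hy.2)) (sub_nonneg.2 he.le)]

theorem f_sub_f {y y' : ℝ} (hy : y ∈ Set.Icc (0 : ℝ) 1) (hy' : y' ∈ Set.Icc (0 : ℝ) 1) :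
    f y - f y' = Real.exp 1
      / ((1 + (Real.exp 1 - 1) * y) * (1 + (Real.exp 1 - 1) * y')) * (y - y') := by
  have h := (den_f_pos hy).ne'
  have h' := (den_f_pos hy').ne'
  rw [f_eq hy.1, f_eq hy'.1, div_sub_div _ _ h h', div_mul_eq_mul_div]
  ring

theorem branch_low (i : Bool) {p : Lam P} (hp : p ∈ low P) :
    branch i p = if i then b₁ p else b₃ p := by
  simp [branch, hp]

theorem branch_up (i : Bool) {p : Lam P} (hp : p ∉ low P) : branch i p = b₂ p := by
  simp [branch, hp]

theorem y_branch_low (i : Bool) {p : Lam P} (hp : p ∈ low P) : (branch i p).1.2.1 = f p.1.2.1 := by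
  cases i <;> simp [branch_low _ hp, b₁_val hp, b₃_val hp]

theorem y_branch_up (i : Bool) {p : Lam P} (hp : p ∉ low P) :
    (branch i p).1.2.1 = P.σ * (1 - p.1.2.1) := by
  simp [branch_up _ hp, b₂_val hp]

theorem x_branch_low (i : Bool) {p : Lam P} (hp : p ∈ low P) : (branch i p).1.1 = P.ρ * p.1.1 := by
  cases i <;> simp [branch_low _ hp, b₁_val hp, b₃_val hp]

theorem x_branch_up (i : Bool) {p : Lam P} (hp : p ∉ low P) :
    (branch i p).1.1 = 3 / 4 - P.ρ * p.1.1 := by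
  simp [branch_up _ hp, b₂_val hp]

theorem branch_true_mem_low (p : Lam P) : branch true p ∈ low P := by
  by_cases hp : p ∈ low P
  · simp [branch_low _ hp, low, b₁_val hp]
  · simp [branch_up _ hp, low, b₂_val hp]

theorem branch_false_mem_low {p : Lam P} : branch false p ∈ low P ↔ p ∉ low P := by
  by_cases hp : p ∈ low P
  · have : branch false p ∉ low P := by simp [branch_low _ hp, low, b₃_val hp]
    simp [hp, this]
  · have : branch false p ∈ low P := by simp [branch_up _ hp, low, b₂_val hp]
    simp [hp, this]

theorem branch_false_not_mem_low {p : Lam P} (hp : p ∈ low P) : branch false p ∉ low P :=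
  fun h => branch_false_mem_low.1 h hp

theorem branch_mem_low_of_not_mem_low (i : Bool) {p : Lam P} (hp : p ∉ low P) :
    branch i p ∈ low P := by
  cases i
  exacts [branch_false_mem_low.2 hp, branch_true_mem_low p]

theorem branchMult_low {p : Lam P} (hp : p ∈ low P) : branchMult p = 1 := by
  simp [branchMult, hp]

theorem branchMult_up {p : Lam P} (hp : p ∉ low P) : branchMult p = 1 / 2 := by
  simp [branchMult, hp]

theorem branchMult_pos (p : Lam P) : 0 < branchMult p := by
  unfold branchMult
  split_ifs <;> norm_num

theorem branchMult_congr {p q : Lam P} (h : p ∈ low P ↔ q ∈ low P) :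
    branchMult p = branchMult q := by
  by_cases hp : p ∈ low P
  · rw [branchMult_low hp, branchMult_low (h.1 hp)]
  · rw [branchMult_up hp, branchMult_up (mt h.2 hp)]

theorem branchWeight_pos (φ : C(Lam P, ℝ)) (i : Bool) (p : Lam P) : 0 < branchWeight φ i p :=
  mul_pos (branchMult_pos p) (Real.exp_pos _)

theorem transferOp_eq_branchSum (φ ψ : C(Lam P, ℝ)) :
    ⇑(transferOp φ ψ) = branchSum branch (branchWeight φ) ψ := by
  funext p
  change transferFun φ ψ p = _
  by_cases hp : p ∈ low P
  · simp [transferFun_low _ _ hp, branchSum_apply, branchWeight, branchMult_low hp, branch_low _ hp]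
  · rw [transferFun_up _ _ hp, branchSum_apply, Fintype.sum_bool]
    simp only [branchWeight, branchMult_up hp, branch_up _ hp]
    ring

theorem transferOp_pow_eq_branchSum_pow (φ ψ : C(Lam P, ℝ)) (n : ℕ) :
    ⇑((transferOp φ ^ n) ψ) = (branchSum branch (branchWeight φ) ^ n) ψ := by
  induction n with
  | zero => rfl
  | succ n ih =>
    rw [pow_succ', pow_succ', mul_apply_eq_comp, Module.End.mul_apply, transferOp_eq_branchSum, ih]

theorem transferOp_mono (φ : C(Lam P, ℝ)) : Monotone (transferOp φ) := by
  intro ψ ψ' h p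
  change transferOp φ ψ p ≤ transferOp φ ψ' p
  rw [transferOp_eq_branchSum, transferOp_eq_branchSum]
  exact branchSum_mono (fun i p => (branchWeight_pos φ i p).le) h p

theorem centralDeriv_nonneg (p : Lam P) : 0 ≤ centralDeriv p := by
  unfold centralDeriv
  split_ifs
  · positivity
  · exact P.σ_pos.le

theorem sqrt_centralDeriv_low {p : Lam P} (hp : p ∈ low P) :
    Real.sqrt (centralDeriv p) = Real.sqrt (Real.exp 1) / (1 + (Real.exp 1 - 1) * p.1.2.1) := by
  simp only [centralDeriv, hp, if_true]
  rw [Real.sqrt_div (Real.exp_pos 1).le, Real.sqrt_sq (den_f_pos (y_mem p)).le]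

theorem centralDeriv_le_one_of_not_mem_low {p : Lam P} (hp : p ∉ low P) : centralDeriv p ≤ 1 := by
  simp only [centralDeriv, hp, if_false]
  linarith [P.σ_lt]

theorem centralDeriv_le (p : Lam P) : centralDeriv p ≤ Real.exp 1 := by
  have he := one_lt_exp_one
  by_cases hp : p ∈ low P
  · simp only [centralDeriv, hp, if_true]
    have hy := y_mem p
    refine div_le_self (Real.exp_pos 1).le (one_le_pow₀ ?_)
    nlinarith [hy.1]
  · exact (centralDeriv_le_one_of_not_mem_low hp).trans he.le

theorem den_logitDeriv_pos (p : Lam P) : 0 < 1 - P.σ * (1 - p.1.2.1) := by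
  have hy := y_mem p
  nlinarith [P.σ_pos, P.σ_lt, hy.1]

theorem logitDeriv_nonneg (p : Lam P) : 0 ≤ logitDeriv p := by
  unfold logitDeriv
  split_ifs
  · exact zero_le_one
  · exact div_nonneg (y_mem p).1 (den_logitDeriv_pos p).le

theorem logitDeriv_up_le {p : Lam P} (hp : p ∉ low P) : logitDeriv p ≤ 1 - (1 - p.1.2.1) / 2 := by
  simp only [logitDeriv, hp, if_false]
  rw [div_le_iff₀ (den_logitDeriv_pos p)]
  have hy := y_mem p
  nlinarith [mul_nonneg (sub_nonneg.2 hy.2) (sub_nonneg.2 P.σ_lt.le), P.σ_pos,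
    mul_nonneg (sub_nonneg.2 hy.2) P.σ_pos.le,
    mul_nonneg (mul_nonneg (sub_nonneg.2 hy.2) P.σ_pos.le) (sub_nonneg.2 hy.2)]

theorem logitDensity_nonneg (p : Lam P) : 0 ≤ logitDensity p :=
  mul_nonneg (y_mem p).1 (sub_nonneg.2 (y_mem p).2)

theorem logitDensity_le_one (p : Lam P) : logitDensity p ≤ 1 := by
  unfold logitDensity
  nlinarith [sq_nonneg (p.1.2.1 - 1 / 2)]

theorem logitDensity_mul_centralDeriv (i : Bool) (p : Lam P) :
    logitDensity p * centralDeriv p = logitDeriv p * logitDensity (branch i p) := by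
  have hy := y_mem p
  unfold logitDensity
  by_cases hp : p ∈ low P
  · have := den_f_pos hy
    rw [y_branch_low i hp, one_sub_f hy, f_eq hy.1]
    simp only [centralDeriv, logitDeriv, hp, if_true]
    field_simp
  · rw [y_branch_up i hp]
    simp only [centralDeriv, logitDeriv, hp, if_false]
    have h := (den_logitDeriv_pos p).ne'
    rw [div_mul_eq_mul_div, eq_div_iff h]
    ring

theorem abs_y_branch_sub (i : Bool) {p q : Lam P} (h : p ∈ low P ↔ q ∈ low P) :
    |(branch i p).1.2.1 - (branch i q).1.2.1|
      = Real.sqrt (centralDeriv p) * Real.sqrt (centralDeriv q) * |p.1.2.1 - q.1.2.1| := by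
  by_cases hp : p ∈ low P
  · have hq := h.1 hp
    have hdp := den_f_pos (y_mem p)
    have hdq := den_f_pos (y_mem q)
    rw [y_branch_low i hp, y_branch_low i hq, f_sub_f (y_mem p) (y_mem q), abs_mul,
      sqrt_centralDeriv_low hp, sqrt_centralDeriv_low hq, div_mul_div_comm,
      Real.mul_self_sqrt (Real.exp_pos 1).le, abs_of_pos (by positivity)]
  · have hq : q ∉ low P := mt h.2 hp
    rw [y_branch_up i hp, y_branch_up i hq, ← mul_sub, abs_mul, abs_of_pos P.σ_pos,
      sub_sub_sub_cancel_left, abs_sub_comm]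
    simp only [centralDeriv, hp, hq, if_false, Real.mul_self_sqrt P.σ_pos.le]

theorem abs_x_branch_sub (i : Bool) {p q : Lam P} (h : p ∈ low P ↔ q ∈ low P) :
    |(branch i p).1.1 - (branch i q).1.1| = P.ρ * |p.1.1 - q.1.1| := by
  by_cases hp : p ∈ low P
  · rw [x_branch_low i hp, x_branch_low i (h.1 hp), ← mul_sub, abs_mul, abs_of_pos P.ρ_pos]
  · rw [x_branch_up i hp, x_branch_up i (mt h.2 hp), sub_sub_sub_cancel_left, ← mul_sub, abs_mul,
      abs_of_pos P.ρ_pos, abs_sub_comm]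

theorem dist_le_one (p q : Lam P) : dist p q ≤ 1 := by
  rw [Subtype.dist_eq, Prod.dist_eq, Prod.dist_eq, Real.dist_eq, Real.dist_eq, Real.dist_eq]
  have h1 := x_mem p
  have h2 := x_mem q
  have h3 := y_mem p
  have h4 := y_mem q
  refine max_le (abs_le.2 ⟨by linarith [h1.1, h2.2], by linarith [h1.2, h2.1]⟩)
    (max_le (abs_le.2 ⟨by linarith [h3.1, h4.2], by linarith [h3.2, h4.1]⟩) ?_)
  rcases z_cases p with h | h <;> rcases z_cases q with h' | h' <;> rw [h, h'] <;>
    norm_num [abs_le]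

theorem dist_of_not_iff {p q : Lam P} (h : ¬(p ∈ low P ↔ q ∈ low P)) : 5 / 6 ≤ dist p q := by
  rw [Subtype.dist_eq, Prod.dist_eq, Prod.dist_eq]
  refine le_max_of_le_right (le_max_of_le_right ?_)
  rw [Real.dist_eq]
  change ¬(p.1.2.2 = 0 ↔ q.1.2.2 = 0) at h
  rcases z_cases p with h1 | h1 <;> rcases z_cases q with h2 | h2 <;> rw [h1, h2] at h ⊢
  · exact absurd Iff.rfl h
  · norm_num
  · norm_num
  · exact absurd Iff.rfl h

theorem dist_eq_max {p q : Lam P} (h : p ∈ low P ↔ q ∈ low P) :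
    dist p q = max |p.1.1 - q.1.1| |p.1.2.1 - q.1.2.1| := by
  have hz : dist p.1.2.2 q.1.2.2 = 0 := by
    change p.1.2.2 = 0 ↔ q.1.2.2 = 0 at h
    rw [dist_eq_zero]
    rcases z_cases p with h1 | h1 <;> rcases z_cases q with h2 | h2 <;> rw [h1, h2] at h ⊢ <;>
      norm_num at h
  rw [Subtype.dist_eq, Prod.dist_eq, Prod.dist_eq, hz, Real.dist_eq, Real.dist_eq]
  rw [max_eq_left (a := |p.1.2.1 - q.1.2.1|) (abs_nonneg _)]

/-! ### Moments of the logit derivative -/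

section LogitMoment

/-- A Lyapunov function on the lower plane: in the logit coordinate it grows linearly towards
`y = 1`, until it reaches its maximum `a + M`. -/
noncomputable def logBarrier (a M y : ℝ) : ℝ := a - Real.log (max (1 - y) (Real.exp (-M)))

variable {a M y : ℝ}

theorem le_logBarrier (hM : 0 ≤ M) (hy : 0 ≤ y) : a ≤ logBarrier a M y := by
  have hlog : Real.log (max (1 - y) (Real.exp (-M))) ≤ 0 :=
    Real.log_nonpos (le_max_of_le_right (Real.exp_pos _).le)
      (max_le (by linarith) (Real.exp_le_one_iff.2 (neg_nonpos.2 hM)))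
  unfold logBarrier
  linarith

theorem logBarrier_le : logBarrier a M y ≤ a + M := by
  have hlog := Real.log_le_log (Real.exp_pos (-M)) (le_max_right (1 - y) (Real.exp (-M)))
  rw [Real.log_exp] at hlog
  unfold logBarrier
  linarith

theorem logBarrier_eq_of_le (h : 1 - y ≤ Real.exp (-M)) : logBarrier a M y = a + M := by
  rw [logBarrier, max_eq_right h, Real.log_exp, sub_neg_eq_add]

theorem logBarrier_le_add_half (hy : y ≤ 1 / 3) : logBarrier a M y ≤ a + 1 / 2 := by
  have hmax : 2 / 3 ≤ max (1 - y) (Real.exp (-M)) := le_max_of_le_left (by linarith)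
  have hlog := (Real.one_sub_inv_le_log_of_pos (by norm_num : (0 : ℝ) < 2 / 3)).trans
    (Real.log_le_log (by norm_num) hmax)
  unfold logBarrier
  linarith

theorem exp_neg_one_mul_le_one_sub_f (hy : y ∈ Set.Icc (0 : ℝ) 1) :
    Real.exp (-1) * (1 - y) ≤ 1 - f y := by
  have hden : 1 + (Real.exp 1 - 1) * y ≤ Real.exp 1 := by
    nlinarith [one_lt_exp_one, hy.2]
  rw [one_sub_f hy, Real.exp_neg, inv_mul_eq_div]
  exact div_le_div_of_nonneg_left (sub_nonneg.2 hy.2) (den_f_pos hy) hden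

theorem logBarrier_f_le (hy : y ∈ Set.Icc (0 : ℝ) 1) :
    logBarrier a M (f y) ≤ logBarrier a M y + 1 := by
  have hmax : Real.exp (-1) * max (1 - y) (Real.exp (-M))
      ≤ max (1 - f y) (Real.exp (-M)) := by
    rw [mul_max_of_nonneg _ _ (Real.exp_pos _).le]
    exact max_le_max (exp_neg_one_mul_le_one_sub_f hy)
      (mul_le_of_le_one_left (Real.exp_pos _).le (Real.exp_le_one_iff.2 (by norm_num)))
  have hpos : 0 < max (1 - y) (Real.exp (-M)) := lt_max_of_lt_right (Real.exp_pos _)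
  have hlog := Real.log_le_log (mul_pos (Real.exp_pos (-1)) hpos) hmax
  rw [Real.log_mul (Real.exp_pos _).ne' hpos.ne', Real.log_exp] at hlog
  unfold logBarrier
  linarith

variable {α κ : ℝ} {p : Lam P}

open Classical in
/-- The Lyapunov function for the moment of order `α` of `logitDeriv`. -/
noncomputable def logitLyapunov (a M α : ℝ) (p : Lam P) : ℝ :=
  if p ∈ low P then logBarrier a M p.1.2.1 else (a + 1 / 2) * logitDeriv p ^ α + 1

theorem logitLyapunov_low (hp : p ∈ low P) : logitLyapunov a M α p = logBarrier a M p.1.2.1 := by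
  simp [logitLyapunov, hp]

theorem logitLyapunov_up (hp : p ∉ low P) :
    logitLyapunov a M α p = (a + 1 / 2) * logitDeriv p ^ α + 1 := by
  simp [logitLyapunov, hp]

theorem logitDeriv_le_one (p : Lam P) : logitDeriv p ≤ 1 := by
  by_cases hp : p ∈ low P
  · simp [logitDeriv, hp]
  · linarith [logitDeriv_up_le hp, (y_mem p).2]

theorem one_le_logitLyapunov (ha : 1 ≤ a) (hM : 0 ≤ M) : 1 ≤ logitLyapunov a M α p := by
  by_cases hp : p ∈ low P
  · rw [logitLyapunov_low hp]
    exact ha.trans (le_logBarrier hM (y_mem p).1)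
  · rw [logitLyapunov_up hp]
    have := Real.rpow_nonneg (logitDeriv_nonneg p) α
    linarith [mul_nonneg (by linarith : 0 ≤ a + 1 / 2) this]

theorem logitLyapunov_le (ha : 1 ≤ a) (hM : 0 ≤ M) (hα : 0 ≤ α) :
    logitLyapunov a M α p ≤ a + M + 3 / 2 := by
  by_cases hp : p ∈ low P
  · rw [logitLyapunov_low hp]
    linarith [logBarrier_le (a := a) (M := M) (y := p.1.2.1)]
  · rw [logitLyapunov_up hp]
    have := Real.rpow_le_one (logitDeriv_nonneg p) (logitDeriv_le_one p) hα
    linarith [mul_le_of_le_one_right (by linarith : 0 ≤ a + 1 / 2) this]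

theorem branchSum_logitLyapunov_up_le (hκ : 1 < κ) (ha : 1 ≤ a) (hp : p ∉ low P) :
    branchSum branch (fun (_ : Bool) p => branchMult p * logitDeriv p ^ α)
      (logitLyapunov a M α) p ≤ κ * logitLyapunov a M α p := by
  have hlow (i : Bool) := branch_mem_low_of_not_mem_low i hp
  have hy : P.σ * (1 - p.1.2.1) ≤ 1 / 3 := by
    nlinarith [P.σ_pos, P.σ_lt, (y_mem p).1]
  have hL := Real.rpow_nonneg (logitDeriv_nonneg p) α
  rw [branchSum_apply, Fintype.sum_bool, logitLyapunov_low (hlow _), logitLyapunov_low (hlow _),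
    y_branch_up _ hp, y_branch_up _ hp, branchMult_up hp, logitLyapunov_up hp]
  calc _ = logitDeriv p ^ α * logBarrier a M (P.σ * (1 - p.1.2.1)) := by ring
    _ ≤ logitDeriv p ^ α * (a + 1 / 2) := by
      gcongr
      exact logBarrier_le_add_half hy
    _ ≤ 1 * ((a + 1 / 2) * logitDeriv p ^ α + 1) := by linarith
    _ ≤ κ * ((a + 1 / 2) * logitDeriv p ^ α + 1) := by gcongr

theorem branchSum_logitLyapunov_low_le (hκ : 1 < κ) (ha : 1 ≤ a) (hα : 0 ≤ α) (hM : 0 ≤ M)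
    (hκa : 3 ≤ (κ - 1) * a) (hκM : a = (κ - 1) * M)
    (hMα : (a + 1 / 2) * (1 - Real.exp (-M - 1) / 2) ^ α ≤ 1) (hp : p ∈ low P) :
    branchSum branch (fun (_ : Bool) p => branchMult p * logitDeriv p ^ α)
      (logitLyapunov a M α) p ≤ κ * logitLyapunov a M α p := by
  have hfalse := branch_false_not_mem_low hp
  have hy := y_mem p
  rw [branchSum_apply, Fintype.sum_bool, logitLyapunov_low (branch_true_mem_low p),
    logitLyapunov_up hfalse, y_branch_low _ hp, branchMult_low hp, logitLyapunov_low hp]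
  simp only [show logitDeriv p = 1 by simp [logitDeriv, hp], Real.one_rpow, one_mul]
  rcases le_total (1 - p.1.2.1) (Real.exp (-M)) with h | h
  · have hup := Real.rpow_le_one (logitDeriv_nonneg _) (logitDeriv_le_one (branch false p)) hα
    rw [logBarrier_eq_of_le h]
    linarith [logBarrier_le (a := a) (M := M) (y := f p.1.2.1),
      mul_le_of_le_one_right (by linarith : 0 ≤ a + 1 / 2) hup]
  · have hgap : Real.exp (-M - 1) ≤ 1 - f p.1.2.1 := by
      rw [sub_eq_neg_add, Real.exp_add]
      exact (mul_le_mul_of_nonneg_left h (Real.exp_pos _).le).trans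
        (exp_neg_one_mul_le_one_sub_f hy)
    have hup : logitDeriv (branch false p) ≤ 1 - Real.exp (-M - 1) / 2 := by
      have := logitDeriv_up_le hfalse
      rw [y_branch_low _ hp] at this
      linarith
    have hpow := mul_le_mul_of_nonneg_left
      (Real.rpow_le_rpow (logitDeriv_nonneg _) hup hα) (by linarith : 0 ≤ a + 1 / 2)
    have hV : (κ - 1) * a ≤ (κ - 1) * logBarrier a M p.1.2.1 :=
      mul_le_mul_of_nonneg_left (le_logBarrier hM hy.1) (by linarith)
    linarith [logBarrier_f_le (a := a) (M := M) hy]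

theorem exists_one_lt_mul_rpow_le_one (A : ℝ) {b : ℝ} (hb0 : 0 ≤ b) (hb1 : b < 1) :
    ∃ α > (1 : ℝ), A * b ^ α ≤ 1 := by
  have hlim := (tendsto_rpow_atTop_of_base_lt_one b (by linarith) hb1).const_mul A
  rw [mul_zero] at hlim
  exact ((Filter.eventually_gt_atTop 1).and (hlim.eventually_le_const one_pos)).exists

theorem exists_moment_logitDeriv_le (P : Params) (hκ : 1 < κ) :
    ∃ α > (1 : ℝ), ∃ C > (0 : ℝ), ∀ n (p : Lam P),
      (branchSum branch (fun (_ : Bool) p => branchMult p * logitDeriv p ^ α) ^ n) 1 p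
        ≤ C * κ ^ n := by
  set a : ℝ := 3 / (κ - 1) + 1
  set M : ℝ := a / (κ - 1)
  have hε : 0 < κ - 1 := sub_pos.2 hκ
  have ha : 1 ≤ a := le_add_of_nonneg_left (div_pos three_pos hε).le
  have hM : 0 ≤ M := div_nonneg (by linarith) hε.le
  have hκa : 3 ≤ (κ - 1) * a := by
    rw [mul_add, mul_div_cancel₀ _ hε.ne']
    linarith
  have hκM : a = (κ - 1) * M := (mul_div_cancel₀ a hε.ne').symm
  have hgap : Real.exp (-M - 1) < 1 := Real.exp_lt_one_iff.2 (by linarith)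
  obtain ⟨α, hα, hMα⟩ := exists_one_lt_mul_rpow_le_one (a + 1 / 2)
    (b := 1 - Real.exp (-M - 1) / 2) (by linarith) (by linarith [Real.exp_pos (-M - 1)])
  have hα0 : 0 ≤ α := by linarith
  have hmono := branchSum_mono (β := branch) (g := fun (_ : Bool) (p : Lam P) =>
    branchMult p * logitDeriv p ^ α) fun _ p =>
      mul_nonneg (branchMult_pos p).le (Real.rpow_nonneg (logitDeriv_nonneg p) α)
  have hlyap := end_pow_apply_le_of_apply_le hmono (by linarith : 0 ≤ κ)
    (m := logitLyapunov a M α) fun p => by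
      by_cases hp : p ∈ low P
      · exact branchSum_logitLyapunov_low_le hκ ha hα0 hM hκa hκM hMα hp
      · exact branchSum_logitLyapunov_up_le hκ ha hp
  refine ⟨α, hα, a + M + 3 / 2, by linarith, fun n p => ?_⟩
  calc _ ≤ _ := monotone_end_pow hmono n (fun p => one_le_logitLyapunov ha hM) p
    _ ≤ κ ^ n * logitLyapunov a M α p := hlyap n p
    _ ≤ (a + M + 3 / 2) * κ ^ n := by
      rw [mul_comm]
      gcongr
      exact logitLyapunov_le ha hM hα0

end LogitMoment

/-! ### Growth of the transfer operator -/

open Real (goldenRatio)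

/-- A Perron eigenvector of the transition graph between the two planes. -/
noncomputable def perronVector (P : Params) : C(Lam P, ℝ) where
  toFun := (low P).indicator (fun _ => goldenRatio - 1) + 1
  continuous_toFun := (continuous_const.indicator (by simp [isClopen_low.frontier_eq])).add
    continuous_one

theorem perronVector_low {p : Lam P} (hp : p ∈ low P) : perronVector P p = goldenRatio := by
  simp [perronVector, hp]

theorem perronVector_up {p : Lam P} (hp : p ∉ low P) : perronVector P p = 1 := by
  simp [perronVector, hp]

theorem one_le_perronVector : 1 ≤ perronVector P := fun p => by
  by_cases hp : p ∈ low P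
  · exact Real.one_lt_goldenRatio.le.trans_eq (perronVector_low hp).symm
  · exact (perronVector_up hp).ge

theorem norm_perronVector_le : ‖perronVector P‖ ≤ goldenRatio :=
  (ContinuousMap.norm_le _ Real.goldenRatio_pos.le).2 fun p => by
    by_cases hp : p ∈ low P
    · rw [perronVector_low hp, Real.norm_of_nonneg Real.goldenRatio_pos.le]
    · rw [perronVector_up hp, norm_one]
      exact Real.one_lt_goldenRatio.le

/-- The iterates of the transfer operator on the Perron vector. -/
noncomputable def perronIter (φ : C(Lam P, ℝ)) (n : ℕ) : C(Lam P, ℝ) :=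
  (transferOp φ ^ n) (perronVector P)

theorem perronIter_zero (φ : C(Lam P, ℝ)) : perronIter φ 0 = perronVector P := rfl

theorem perronIter_succ (φ : C(Lam P, ℝ)) (n : ℕ) :
    ⇑(perronIter φ (n + 1)) = branchSum branch (branchWeight φ) (perronIter φ n) := by
  rw [perronIter, pow_succ', mul_apply_eq_comp, transferOp_eq_branchSum, perronIter]

theorem exp_le_exp_iSup (φ : C(Lam P, ℝ)) (p : Lam P) :
    Real.exp (φ p) ≤ Real.exp (⨆ x, φ x) :=
  Real.exp_le_exp.2 (le_ciSup (isCompact_range φ.continuous).bddAbove p)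

theorem exp_iInf_le_exp (φ : C(Lam P, ℝ)) (p : Lam P) :
    Real.exp (⨅ x, φ x) ≤ Real.exp (φ p) :=
  Real.exp_le_exp.2 (ciInf_le (isCompact_range φ.continuous).bddBelow p)

theorem branchWeight_le (φ : C(Lam P, ℝ)) (i : Bool) (p : Lam P) :
    branchWeight φ i p ≤ Real.exp (⨆ x, φ x) * branchMult p := by
  rw [mul_comm]
  exact mul_le_mul_of_nonneg_left (exp_le_exp_iSup φ _) (branchMult_pos p).le

theorem branchMult_le_one (p : Lam P) : branchMult p ≤ 1 := by
  unfold branchMult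
  split_ifs <;> norm_num

/-- The growth rate `ω` of the number of inverse branches, times the least value of `exp φ`. -/
noncomputable def lowerRate (φ : C(Lam P, ℝ)) : ℝ := goldenRatio * Real.exp (⨅ x, φ x)

theorem lowerRate_pos (φ : C(Lam P, ℝ)) : 0 < lowerRate φ :=
  mul_pos Real.goldenRatio_pos (Real.exp_pos _)

theorem lowerRate_smul_perronVector_le (φ : C(Lam P, ℝ)) :
    lowerRate φ • ⇑(perronVector P) ≤ branchSum branch (branchWeight φ) (perronVector P) := by
  intro p
  have hω := Real.goldenRatio_pos
  have hexp i := exp_iInf_le_exp φ (branch i p)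
  rw [Pi.smul_apply, smul_eq_mul, branchSum_apply, Fintype.sum_bool, lowerRate,
    perronVector_low (branch_true_mem_low p)]
  unfold branchWeight
  by_cases hp : p ∈ low P
  · rw [perronVector_low hp, perronVector_up (branch_false_not_mem_low hp),
      branchMult_low hp]
    linarith [mul_le_mul_of_nonneg_right (hexp true) hω.le, hexp false,
      congrArg (Real.exp (⨅ x, φ x) * ·) Real.goldenRatio_sq]
  · rw [perronVector_up hp, perronVector_low (branch_false_mem_low.2 hp), branchMult_up hp]
    linarith [mul_le_mul_of_nonneg_right (hexp true) hω.le,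
      mul_le_mul_of_nonneg_right (hexp false) hω.le]

theorem lowerRate_mul_perronIter_le (φ : C(Lam P, ℝ)) (n : ℕ) (p : Lam P) :
    lowerRate φ * perronIter φ n p ≤ perronIter φ (n + 1) p := by
  have hmono := monotone_end_pow
    (branchSum_mono (β := branch) fun i (p : Lam P) => (branchWeight_pos φ i p).le) n
  have h := hmono (lowerRate_smul_perronVector_le φ) p
  rwa [map_smul, ← Module.End.mul_apply, ← pow_succ, ← transferOp_pow_eq_branchSum_pow,
    ← transferOp_pow_eq_branchSum_pow] at h

theorem perronIter_pos (φ : C(Lam P, ℝ)) (n : ℕ) (p : Lam P) : 0 < perronIter φ n p := by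
  induction n with
  | zero => exact zero_lt_one.trans_le (one_le_perronVector p)
  | succ n ih => exact (mul_pos (lowerRate_pos φ) ih).trans_le (lowerRate_mul_perronIter_le φ n p)

theorem perronIter_le_norm (φ : C(Lam P, ℝ)) (n : ℕ) (p : Lam P) :
    perronIter φ n p ≤ ‖perronIter φ n‖ :=
  (le_abs_self _).trans ((perronIter φ n).norm_coe_le_norm p)

theorem lowerRate_mul_norm_perronIter_le (φ : C(Lam P, ℝ)) (n : ℕ) :
    lowerRate φ * ‖perronIter φ n‖ ≤ ‖perronIter φ (n + 1)‖ := by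
  rw [← Real.norm_of_nonneg (lowerRate_pos φ).le, ← norm_smul]
  exact norm_le_norm_of_nonneg_of_le
    (fun p => (mul_pos (lowerRate_pos φ) (perronIter_pos φ n p)).le)
    (lowerRate_mul_perronIter_le φ n)

theorem lowerRate_pow_mul_norm_perronIter_le (φ : C(Lam P, ℝ)) (j m : ℕ) :
    lowerRate φ ^ j * ‖perronIter φ m‖ ≤ ‖perronIter φ (j + m)‖ := by
  induction j with
  | zero => simp
  | succ j ih =>
    rw [pow_succ', mul_assoc, Nat.add_right_comm]
    exact (mul_le_mul_of_nonneg_left ih (lowerRate_pos φ).le).trans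
      (lowerRate_mul_norm_perronIter_le φ _)

theorem norm_perronIter_succ_le (φ : C(Lam P, ℝ)) (n : ℕ) :
    ‖perronIter φ (n + 1)‖ ≤ 2 * Real.exp (⨆ x, φ x) * ‖perronIter φ n‖ := by
  refine (ContinuousMap.norm_le _ (by positivity)).2 fun p => ?_
  rw [Real.norm_of_nonneg (perronIter_pos φ _ p).le, perronIter_succ, branchSum_apply,
    Fintype.sum_bool]
  have hterm i : branchWeight φ i p * perronIter φ n (branch i p)
      ≤ Real.exp (⨆ x, φ x) * ‖perronIter φ n‖ :=
    mul_le_mul ((branchWeight_le φ i p).trans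
      (mul_le_of_le_one_right (Real.exp_pos _).le (branchMult_le_one p)))
      (perronIter_le_norm φ n _) (perronIter_pos φ n _).le (Real.exp_pos _).le
  linarith [hterm true, hterm false]

/-! ### Cocycles over pairs of points -/

/-- Pairs of points of `Λ` in the same horizontal plane, on which the same inverse branches act. -/
abbrev SamePlane (P : Params) : Type := {s : Lam P × Lam P // s.1 ∈ low P ↔ s.2 ∈ low P}

theorem branch_mem_low_iff (i : Bool) {p q : Lam P} (h : p ∈ low P ↔ q ∈ low P) :
    branch i p ∈ low P ↔ branch i q ∈ low P := by
  cases i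
  · rw [branch_false_mem_low, branch_false_mem_low, h]
  · exact iff_of_true (branch_true_mem_low p) (branch_true_mem_low q)

/-- The inverse branches acting simultaneously on both points of a pair. -/
noncomputable def branchPair (i : Bool) (s : SamePlane P) : SamePlane P :=
  ⟨(branch i s.1.1, branch i s.1.2), branch_mem_low_iff i s.2⟩

/-- The transfer operator for the first point of a pair, with its weights multiplied by the cocycle
generated by `d`, iterated `j` times on `perronIter φ m`. For `d = 1` this is
`perronIter φ (j + m)`, so the quotient of the two is an average of the cocycle. -/
noncomputable def cocycleSum (φ : C(Lam P, ℝ)) (d : SamePlane P → ℝ) (j m : ℕ) :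
    SamePlane P → ℝ :=
  (branchSum branchPair (fun i s => branchWeight φ i s.1.1 * d s) ^ j)
    fun s => perronIter φ m s.1.1

section CocycleSum

variable {φ : C(Lam P, ℝ)} {d d' : SamePlane P → ℝ}

theorem cocycleWeight_nonneg (hd : 0 ≤ d) :
    0 ≤ fun (i : Bool) (s : SamePlane P) => branchWeight φ i s.1.1 * d s := fun i s =>
  mul_nonneg (branchWeight_pos φ i s.1.1).le (hd s)

theorem cocycleWeight_le {b : ℝ} (hd : 0 ≤ d) (hdb : ∀ s, d s ≤ b) (i : Bool) (s : SamePlane P) :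
    branchWeight φ i s.1.1 * d s ≤ Real.exp (⨆ x, φ x) * b :=
  mul_le_mul ((branchWeight_le φ i _).trans
    (mul_le_of_le_one_right (Real.exp_pos _).le (branchMult_le_one _))) (hdb s) (hd s)
    (Real.exp_pos _).le

theorem cocycleSum_nonneg (hd : 0 ≤ d) (j m : ℕ) : 0 ≤ cocycleSum φ d j m :=
  branchSum_pow_nonneg (cocycleWeight_nonneg hd) (fun _ => (perronIter_pos φ m _).le) j

theorem cocycleSum_succ (j m : ℕ) (s : SamePlane P) :
    cocycleSum φ d (j + 1) m s
      = ∑ i, branchWeight φ i s.1.1 * d s * cocycleSum φ d j m (branchPair i s) := by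
  rw [cocycleSum, pow_succ', Module.End.mul_apply, branchSum_apply]
  rfl

theorem cocycleSum_comp_fst (k : Lam P → ℝ) (j m : ℕ) (s : SamePlane P) :
    cocycleSum φ (fun s => k s.1.1) j m s
      = (branchSum branch (fun i p => branchWeight φ i p * k p) ^ j) (perronIter φ m) s.1.1 :=
  congrFun (branchSum_pow_comp (π := fun s : SamePlane P => s.1.1) (β' := branch)
    (k := fun i p => branchWeight φ i p * k p) (fun _ _ => rfl) (perronIter φ m) j) s

theorem cocycleSum_one (j m : ℕ) (s : SamePlane P) :
    cocycleSum φ 1 j m s = perronIter φ (j + m) s.1.1 := by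
  have h := cocycleSum_comp_fst (φ := φ) 1 j m s
  simp only [Pi.one_apply, mul_one] at h
  rw [← transferOp_pow_eq_branchSum_pow] at h
  rw [perronIter, pow_add, mul_apply_eq_comp]
  exact h

theorem cocycleSum_smul (c : ℝ) (j m : ℕ) :
    cocycleSum φ (c • d) j m = c ^ j • cocycleSum φ d j m := by
  have hweight : (fun (i : Bool) (s : SamePlane P) => branchWeight φ i s.1.1 * (c • d) s)
      = c • fun i s => branchWeight φ i s.1.1 * d s := by
    funext i s
    simp only [Pi.smul_apply, smul_eq_mul, mul_left_comm c]
  rw [cocycleSum, hweight, branchSum_smul, smul_pow]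
  rfl

theorem mul_cocycleSum {w : SamePlane P → ℝ} (hw : ∀ i s, w s * d s = d' s * w (branchPair i s))
    (j m : ℕ) :
    w * cocycleSum φ d j m
      = (branchSum branchPair (fun i s => branchWeight φ i s.1.1 * d' s) ^ j)
        (w * fun s => perronIter φ m s.1.1) :=
  mul_branchSum_pow (fun i s => by rw [mul_left_comm, hw i s, mul_assoc]) _ j

end CocycleSum

theorem exists_one_le_and_mul_add_le {a b : ℝ} (c : ℝ) (h : a < b) :
    ∃ K, 1 ≤ K ∧ a * (K + c) ≤ K * b := by
  refine ⟨max 1 (c * a / (b - a)), le_max_left _ _, ?_⟩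
  have hK := le_max_right 1 (c * a / (b - a))
  rw [div_le_iff₀ (sub_pos.2 h)] at hK
  linarith

/-- The average of the cocycle generated by `d` over the inverse branches of order `j` decays like
`θ ^ j`, uniformly on the set `Q` of pairs. -/
def DecaysOn (φ : C(Lam P, ℝ)) (d : SamePlane P → ℝ) (θ : ℝ) (Q : Set (SamePlane P)) : Prop :=
  ∃ C : ℝ, 0 ≤ C ∧ ∀ j m, ∀ s ∈ Q, cocycleSum φ d j m s ≤ C * θ ^ j * ‖perronIter φ (j + m)‖

namespace DecaysOn

variable {φ : C(Lam P, ℝ)} {d d' : SamePlane P → ℝ} {θ θ' : ℝ} {Q Q' : Set (SamePlane P)}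

theorem union (hθ : 0 ≤ θ) (h : DecaysOn φ d θ Q) (h' : DecaysOn φ d θ Q') :
    DecaysOn φ d θ (Q ∪ Q') := by
  obtain ⟨C, hC, h⟩ := h
  obtain ⟨C', -, h'⟩ := h'
  refine ⟨max C C', le_max_of_le_left hC, fun j m s hs => ?_⟩
  rcases hs with hs | hs
  · exact (h j m s hs).trans (by gcongr; exact le_max_left _ _)
  · exact (h' j m s hs).trans (by gcongr; exact le_max_right _ _)

theorem mono (h : DecaysOn φ d θ Q) (hQ : Q' ⊆ Q) : DecaysOn φ d θ Q' := by
  obtain ⟨C, hC, h⟩ := h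
  exact ⟨C, hC, fun j m s hs => h j m s (hQ hs)⟩

theorem mono_rate (hθ : 0 ≤ θ) (hθθ' : θ ≤ θ') (h : DecaysOn φ d θ Q) : DecaysOn φ d θ' Q := by
  obtain ⟨C, hC, h⟩ := h
  exact ⟨C, hC, fun j m s hs => (h j m s hs).trans (by gcongr)⟩

theorem one : DecaysOn φ 1 1 Set.univ := by
  refine ⟨1, zero_le_one, fun j m s _ => ?_⟩
  rw [cocycleSum_one, one_pow, one_mul, one_mul]
  exact perronIter_le_norm φ _ _

theorem smul {c : ℝ} (hc : 0 ≤ c) (h : DecaysOn φ d θ Q) : DecaysOn φ (c • d) (c * θ) Q := by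
  obtain ⟨C, hC, h⟩ := h
  refine ⟨C, hC, fun j m s hs => ?_⟩
  calc cocycleSum φ (c • d) j m s = c ^ j * cocycleSum φ d j m s := by rw [cocycleSum_smul]; rfl
    _ ≤ c ^ j * (C * θ ^ j * ‖perronIter φ (j + m)‖) := by gcongr; exact h j m s hs
    _ = C * (c * θ) ^ j * ‖perronIter φ (j + m)‖ := by ring

theorem rpow_mul_rpow {t : ℝ} (ht0 : 0 < t) (ht1 : t < 1) (hd : 0 ≤ d) (hd' : 0 ≤ d') (hθ : 0 ≤ θ)
    (hθ' : 0 ≤ θ') (h : DecaysOn φ d θ Q) (h' : DecaysOn φ d' θ' Q) :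
    DecaysOn φ (fun s => d s ^ (1 - t) * d' s ^ t) (θ ^ (1 - t) * θ' ^ t) Q := by
  obtain ⟨C, hC, h⟩ := h
  obtain ⟨C', hC', h'⟩ := h'
  have ht1' : 0 < 1 - t := sub_pos.2 ht1
  have hsplit {a : ℝ} (ha : 0 ≤ a) : a ^ (1 - t) * a ^ t = a := by
    rw [← Real.rpow_add_of_nonneg ha ht1'.le ht0.le, sub_add_cancel, Real.rpow_one]
  have hweight (i : Bool) (s : SamePlane P) :
      branchWeight φ i s.1.1 * (d s ^ (1 - t) * d' s ^ t)
        = (branchWeight φ i s.1.1 * d s) ^ (1 - t) * (branchWeight φ i s.1.1 * d' s) ^ t := by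
    have hw := (branchWeight_pos φ i s.1.1).le
    rw [Real.mul_rpow hw (hd s), Real.mul_rpow hw (hd' s), mul_mul_mul_comm, hsplit hw]
  refine ⟨C ^ (1 - t) * C' ^ t, by positivity, fun j m s hs => ?_⟩
  set N := ‖perronIter φ (j + m)‖
  have hN : 0 ≤ N := norm_nonneg _
  calc cocycleSum φ (fun s => d s ^ (1 - t) * d' s ^ t) j m s
      ≤ cocycleSum φ d j m s ^ (1 - t) * cocycleSum φ d' j m s ^ t := by
        simp only [cocycleSum, hweight]
        exact branchSum_pow_rpow_le ht0 ht1 (cocycleWeight_nonneg hd) (cocycleWeight_nonneg hd')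
          (fun s => (perronIter_pos φ m s.1.1).le) j s
    _ ≤ (C * θ ^ j * N) ^ (1 - t) * (C' * θ' ^ j * N) ^ t :=
        mul_le_mul (Real.rpow_le_rpow (cocycleSum_nonneg hd j m s) (h j m s hs) ht1'.le)
          (Real.rpow_le_rpow (cocycleSum_nonneg hd' j m s) (h' j m s hs) ht0.le)
          (Real.rpow_nonneg (cocycleSum_nonneg hd' j m s) t) (by positivity)
    _ = C ^ (1 - t) * C' ^ t * (θ ^ (1 - t) * θ' ^ t) ^ j * (N ^ (1 - t) * N ^ t) := by
        rw [Real.mul_rpow (by positivity) hN, Real.mul_rpow (by positivity) hN,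
          Real.mul_rpow hC (by positivity), Real.mul_rpow hC' (by positivity),
          ← Real.rpow_pow_comm hθ, ← Real.rpow_pow_comm hθ']
        ring
    _ = C ^ (1 - t) * C' ^ t * (θ ^ (1 - t) * θ' ^ t) ^ j * N := by rw [hsplit hN]

theorem of_coboundary {w : SamePlane P → ℝ} {η : ℝ} (hη : 0 < η) (hd : 0 ≤ d) (hd' : 0 ≤ d')
    (hw1 : w ≤ 1) (hw : ∀ i s, w s * d s = d' s * w (branchPair i s))
    (h : DecaysOn φ d' θ Set.univ) : DecaysOn φ d θ {s | η ≤ w s} := by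
  obtain ⟨C, hC, h⟩ := h
  refine ⟨C / η, div_nonneg hC hη.le, fun j m s hs => ?_⟩
  have hle : (w * fun s => perronIter φ m s.1.1) ≤ fun s => perronIter φ m s.1.1 := fun s =>
    mul_le_of_le_one_left (perronIter_pos φ m s.1.1).le (hw1 s)
  rw [div_mul_eq_mul_div, div_mul_eq_mul_div, le_div_iff₀' hη]
  calc η * cocycleSum φ d j m s ≤ (w * cocycleSum φ d j m) s :=
        mul_le_mul_of_nonneg_right hs (cocycleSum_nonneg hd j m s)
    _ ≤ cocycleSum φ d' j m s := by
        rw [mul_cocycleSum hw]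
        exact monotone_end_pow (branchSum_mono (cocycleWeight_nonneg hd')) j hle s
    _ ≤ C * θ ^ j * ‖perronIter φ (j + m)‖ := h j m s trivial

/-- A region that only one branch can map into itself inherits the decay from the regions reached
by the other branch: the weight of a single branch is beaten by the growth rate. -/
theorem of_branches {b : ℝ} (hθ : 0 < θ) (hd : 0 ≤ d) (hdb : ∀ s, d s ≤ b)
    (hbθ : Real.exp (⨆ x, φ x) * b < θ * lowerRate φ) (h : DecaysOn φ d θ Q')
    (hQt : ∀ s ∈ Q, branchPair true s ∈ Q ∪ Q') (hQf : ∀ s ∈ Q, branchPair false s ∈ Q') :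
    DecaysOn φ d θ Q := by
  obtain ⟨C, hC, h⟩ := h
  set A := Real.exp (⨆ x, φ x) * b
  obtain ⟨K, hK1, hK⟩ := exists_one_le_and_mul_add_le (2 * C) hbθ
  have hweight : ∀ i s, branchWeight φ i s.1.1 * d s ≤ A := cocycleWeight_le hd hdb
  refine ⟨K, zero_le_one.trans hK1, fun j m => ?_⟩
  induction j with
  | zero =>
    intro s _
    rw [pow_zero, mul_one, zero_add]
    exact (perronIter_le_norm φ m s.1.1).trans (le_mul_of_one_le_left (norm_nonneg _) hK1)
  | succ j ih =>
    intro s hs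
    have hA : 0 ≤ A := (cocycleWeight_nonneg hd true s).trans (hweight true s)
    set B := θ ^ j * ‖perronIter φ (j + m)‖
    have hB : 0 ≤ B := by positivity
    have ht : cocycleSum φ d j m (branchPair true s) ≤ (K + C) * B := by
      rcases hQt s hs with hQ | hQ'
      · linarith [ih _ hQ, mul_nonneg hC hB]
      · linarith [h j m _ hQ', mul_nonneg (zero_le_one.trans hK1) hB]
    have hf : cocycleSum φ d j m (branchPair false s) ≤ C * B := by linarith [h j m _ (hQf s hs)]
    rw [cocycleSum_succ, Fintype.sum_bool, Nat.add_right_comm]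
    calc _ ≤ A * ((K + C) * B) + A * (C * B) := add_le_add
          (mul_le_mul (hweight true s) ht (cocycleSum_nonneg hd j m _) hA)
          (mul_le_mul (hweight false s) hf (cocycleSum_nonneg hd j m _) hA)
      _ = A * (K + 2 * C) * B := by ring
      _ ≤ K * (θ * lowerRate φ) * B := mul_le_mul_of_nonneg_right hK hB
      _ = K * θ ^ (j + 1) * (lowerRate φ * ‖perronIter φ (j + m)‖) := by ring
      _ ≤ _ := by gcongr; exact lowerRate_mul_norm_perronIter_le φ _

end DecaysOn

/-! ### Decay of the derivatives -/

section DerivativeDecay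

variable {φ : C(Lam P, ℝ)} {r θ : ℝ}

theorem cocycleSum_comp_snd_le {k : Lam P → ℝ} (hk : 0 ≤ k) (j m : ℕ) (s : SamePlane P) :
    cocycleSum φ (fun s => k s.1.2) j m s
      ≤ Real.exp (⨆ x, φ x) ^ j * ‖perronIter φ m‖
        * (branchSum branch (fun (_ : Bool) p => branchMult p * k p) ^ j) 1 s.1.2 := by
  set E := Real.exp (⨆ x, φ x)
  set N := ‖perronIter φ m‖
  set g : Bool → SamePlane P → ℝ := fun _ s => branchMult s.1.2 * k s.1.2
  have hweight : (fun i (s : SamePlane P) => branchWeight φ i s.1.1 * k s.1.2) ≤ E • g := by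
    intro i s
    change _ ≤ E * (branchMult s.1.2 * k s.1.2)
    rw [← branchMult_congr s.2, ← mul_assoc]
    exact mul_le_mul_of_nonneg_right (branchWeight_le φ i s.1.1) (hk _)
  have hweight0 := cocycleWeight_nonneg (φ := φ) fun s : SamePlane P => hk s.1.2
  have hiter : (fun s : SamePlane P => perronIter φ m s.1.1) ≤ N • 1 := fun s =>
    (perronIter_le_norm φ m s.1.1).trans_eq (mul_one _).symm
  have hcomp := branchSum_pow_comp (β := branchPair) (β' := branch)
    (k := fun _ p => branchMult p * k p) (π := fun s : SamePlane P => s.1.2) (fun _ _ => rfl) 1 j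
  calc cocycleSum φ (fun s => k s.1.2) j m s
      ≤ (branchSum branchPair (E • g) ^ j) (fun s => perronIter φ m s.1.1) s :=
        branchSum_pow_mono_weight hweight0 hweight (fun s => (perronIter_pos φ m s.1.1).le) j s
    _ ≤ (branchSum branchPair (E • g) ^ j) (N • 1) s :=
        monotone_end_pow (branchSum_mono (hweight0.trans hweight)) j hiter s
    _ = N * (E ^ j * (branchSum branchPair g ^ j) 1 s) := by
        rw [map_smul, branchSum_smul, smul_pow]
        rfl
    _ = N * (E ^ j * (branchSum branch (fun _ p => branchMult p * k p) ^ j) 1 s.1.2) :=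
        congrArg (fun c => N * (E ^ j * c)) (congrFun hcomp s)
    _ = _ := by rw [← mul_assoc, mul_comm N]

theorem exists_decaysOn_logitDeriv_moment (φ : C(Lam P, ℝ)) {κ : ℝ} (hκ : 1 < κ) :
    ∃ α > (1 : ℝ), DecaysOn φ (fun s => logitDeriv s.1.2 ^ α)
      (κ * Real.exp (⨆ x, φ x) / lowerRate φ) Set.univ := by
  obtain ⟨α, hα, C, hC, hmoment⟩ := exists_moment_logitDeriv_le P hκ
  refine ⟨α, hα, C, hC.le, fun j m s _ => ?_⟩
  have hrate := lowerRate_pos φ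
  refine (cocycleSum_comp_snd_le (fun p => Real.rpow_nonneg (logitDeriv_nonneg p) α) j m s).trans ?_
  calc _ ≤ Real.exp (⨆ x, φ x) ^ j * ‖perronIter φ m‖ * (C * κ ^ j) := by
        gcongr
        exact hmoment j s.1.2
    _ = C * (κ * Real.exp (⨆ x, φ x) / lowerRate φ) ^ j
          * (lowerRate φ ^ j * ‖perronIter φ m‖) := by
        rw [div_pow, mul_pow]
        field_simp
    _ ≤ _ := by
        gcongr
        exact lowerRate_pow_mul_norm_perronIter_le φ j m

theorem exists_decaysOn_logitDeriv_rpow (hφ : Real.exp (⨆ x, φ x) < lowerRate φ) (hr0 : 0 < r)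
    (hr1 : r ≤ 1) :
    ∃ θ ∈ Set.Ioo (0 : ℝ) 1, DecaysOn φ (fun s => logitDeriv s.1.2 ^ r) θ Set.univ := by
  obtain ⟨κ, hκ1, hκ⟩ := exists_between ((one_lt_div (Real.exp_pos _)).2 hφ)
  obtain ⟨α, hα, hmoment⟩ := exists_decaysOn_logitDeriv_moment φ hκ1
  set μ := κ * Real.exp (⨆ x, φ x) / lowerRate φ
  have hμ0 : 0 < μ := div_pos (mul_pos (zero_lt_one.trans hκ1) (Real.exp_pos _)) (lowerRate_pos φ)
  have hμ1 : μ < 1 := (div_lt_one (lowerRate_pos φ)).2 ((lt_div_iff₀ (Real.exp_pos _)).1 hκ)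
  have hα0 : 0 < α := zero_lt_one.trans hα
  have ht0 : 0 < r / α := div_pos hr0 hα0
  have ht1 : r / α < 1 := (div_lt_one hα0).2 (hr1.trans_lt hα)
  refine ⟨μ ^ (r / α), ⟨Real.rpow_pos_of_pos hμ0 _, Real.rpow_lt_one hμ0.le hμ1 ht0⟩, ?_⟩
  have h := DecaysOn.one.rpow_mul_rpow ht0 ht1 zero_le_one
    (fun s => Real.rpow_nonneg (logitDeriv_nonneg s.1.2) α) zero_le_one hμ0.le hmoment
  simpa only [Pi.one_apply, Real.one_rpow, one_mul, ← Real.rpow_mul (logitDeriv_nonneg _),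
    mul_div_cancel₀ r hα0.ne'] using h

theorem decaysOn_centralDeriv_of_logitDensity (hr : 0 < r) {η : ℝ} (hη : 0 < η)
    (h : DecaysOn φ (fun s => logitDeriv s.1.2 ^ r) θ Set.univ) :
    DecaysOn φ (fun s => centralDeriv s.1.2 ^ r) θ {s | η ≤ logitDensity s.1.2} := by
  have hcob := h.of_coboundary (d := fun s => centralDeriv s.1.2 ^ r)
    (w := fun s => logitDensity s.1.2 ^ r) (Real.rpow_pos_of_pos hη r)
    (fun _ => Real.rpow_nonneg (centralDeriv_nonneg _) r)
    (fun _ => Real.rpow_nonneg (logitDeriv_nonneg _) r)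
    (fun _ => Real.rpow_le_one (logitDensity_nonneg _) (logitDensity_le_one _) hr.le) fun i s => by
      change _ = _ * logitDensity (branch i s.1.2) ^ r
      rw [← Real.mul_rpow (logitDensity_nonneg _) (centralDeriv_nonneg _),
        ← Real.mul_rpow (logitDeriv_nonneg _) (logitDensity_nonneg _),
        logitDensity_mul_centralDeriv i]
  exact hcob.mono fun _ hs => Real.rpow_le_rpow hη.le hs hr.le

theorem f_le_half {y : ℝ} (hy0 : 0 ≤ y) (hy : y ≤ 1 / 6) : f y ≤ 1 / 2 := by
  have he : Real.exp 1 < 3 := Real.exp_one_lt_d9.trans (by norm_num)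
  have hden : 0 < 1 + (Real.exp 1 - 1) * y := den_f_pos ⟨hy0, by linarith⟩
  rw [f_eq hy0, div_le_iff₀ hden]
  nlinarith

theorem le_logitDensity {p : Lam P} {η : ℝ} (hη : 0 ≤ η) (h0 : η ≤ p.1.2.1)
    (h1 : η ≤ 1 - p.1.2.1) : η ^ 2 ≤ logitDensity p := by
  rw [sq]
  exact mul_le_mul h0 h1 hη (hη.trans h0)

theorem decaysOn_centralDeriv_of_branches (hr : 0 ≤ r) (hθ : 0 < θ)
    (hrθ : Real.exp (⨆ x, φ x) * Real.exp r < θ * lowerRate φ) {Q Q' : Set (Lam P)}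
    (h : DecaysOn φ (fun s => centralDeriv s.1.2 ^ r) θ {s | s.1.2 ∈ Q'})
    (hQt : ∀ p ∈ Q, branch true p ∈ Q ∪ Q') (hQf : ∀ p ∈ Q, branch false p ∈ Q') :
    DecaysOn φ (fun s => centralDeriv s.1.2 ^ r) θ {s | s.1.2 ∈ Q} :=
  h.of_branches hθ (fun _ => Real.rpow_nonneg (centralDeriv_nonneg _) r)
    (fun _ => (Real.rpow_le_rpow (centralDeriv_nonneg _) (centralDeriv_le _) hr).trans_eq
      (Real.exp_one_rpow r)) hrθ (fun s => hQt s.1.2) fun s => hQf s.1.2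

end DerivativeDecay

section CentralDecay

variable {φ : C(Lam P, ℝ)} {r θ : ℝ} {p : Lam P}

/-- The points at distance at least `σ / 2`, up to a square, from both ends of the central
direction. -/
def middleRegion (P : Params) : Set (Lam P) := {p | (P.σ / 2) ^ 2 ≤ logitDensity p}

/-- The half of the upper plane that the inverse branches map to the middle region. -/
def upperLeft (P : Params) : Set (Lam P) := {p | p ∉ low P ∧ p.1.2.1 ≤ 1 / 2}

/-- The half of the upper plane that the inverse branches map close to `y = 0`. -/
def upperRight (P : Params) : Set (Lam P) := {p | p ∉ low P ∧ 1 / 2 ≤ p.1.2.1}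

/-- The part of the lower plane close to the repelling fixed point `0` of `f`. -/
def lowerLeft (P : Params) : Set (Lam P) := {p | p ∈ low P ∧ p.1.2.1 ≤ P.σ / 2}

/-- The part of the lower plane close to the attracting fixed point `1` of `f`. -/
def lowerRight (P : Params) : Set (Lam P) := {p | p ∈ low P ∧ 1 - P.σ / 2 ≤ p.1.2.1}

theorem mem_middleRegion (h0 : P.σ / 2 ≤ p.1.2.1) (h1 : P.σ / 2 ≤ 1 - p.1.2.1) :
    p ∈ middleRegion P :=
  le_logitDensity (half_pos P.σ_pos).le h0 h1

theorem branch_mem_middleRegion (i : Bool) (hp : p ∈ upperLeft P) :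
    branch i p ∈ middleRegion P := by
  have hy := y_branch_up i hp.1
  apply mem_middleRegion <;> rw [hy] <;> nlinarith [hp.2, (y_mem p).1, P.σ_pos, P.σ_lt]

theorem branch_mem_lowerLeft (i : Bool) (hp : p ∈ upperRight P) : branch i p ∈ lowerLeft P := by
  refine ⟨branch_mem_low_of_not_mem_low i hp.1, ?_⟩
  rw [y_branch_up i hp.1]
  nlinarith [hp.2, P.σ_pos]

theorem y_branch_le_half (i : Bool) (hp : p ∈ lowerLeft P) : (branch i p).1.2.1 ≤ 1 / 2 := by
  rw [y_branch_low i hp.1]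
  exact f_le_half (y_mem p).1 (by linarith [hp.2, P.σ_lt])

theorem branch_true_mem_of_lowerLeft (hp : p ∈ lowerLeft P) :
    branch true p ∈ lowerLeft P ∪ middleRegion P := by
  rcases le_total (branch true p).1.2.1 (P.σ / 2) with hy | hy
  · exact Or.inl ⟨branch_true_mem_low p, hy⟩
  · exact Or.inr (mem_middleRegion hy (by linarith [y_branch_le_half true hp, P.σ_lt]))

theorem le_y_branch (i : Bool) (hp : p ∈ lowerRight P) : 1 - P.σ / 2 ≤ (branch i p).1.2.1 := by
  rw [y_branch_low i hp.1]
  exact hp.2.trans (le_f (y_mem p))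

theorem regions_cover (p : Lam P) :
    p ∈ (((middleRegion P ∪ upperLeft P) ∪ lowerLeft P) ∪ upperRight P) ∪ lowerRight P := by
  by_cases hp : p ∈ low P
  · rcases le_total p.1.2.1 (P.σ / 2) with h0 | h0
    · exact Or.inl (Or.inl (Or.inr ⟨hp, h0⟩))
    · rcases le_total (1 - P.σ / 2) p.1.2.1 with h1 | h1
      · exact Or.inr ⟨hp, h1⟩
      · exact Or.inl (Or.inl (Or.inl (Or.inl (mem_middleRegion h0 (by linarith)))))
  · rcases le_total p.1.2.1 (1 / 2) with h | h
    · exact Or.inl (Or.inl (Or.inl (Or.inr ⟨hp, h⟩)))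
    · exact Or.inl (Or.inr ⟨hp, h⟩)

theorem decaysOn_centralDeriv_snd (hr : 0 < r) (hθ : 0 < θ)
    (hrθ : Real.exp (⨆ x, φ x) * Real.exp r < θ * lowerRate φ)
    (h : DecaysOn φ (fun s => logitDeriv s.1.2 ^ r) θ Set.univ) :
    DecaysOn φ (fun s => centralDeriv s.1.2 ^ r) θ Set.univ := by
  have hmid : DecaysOn φ (fun s => centralDeriv s.1.2 ^ r) θ {s | s.1.2 ∈ middleRegion P} :=
    decaysOn_centralDeriv_of_logitDensity hr (pow_pos (half_pos P.σ_pos) 2) h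
  have hupL := decaysOn_centralDeriv_of_branches hr.le hθ hrθ (Q := upperLeft P) hmid
    (fun _ hp => Or.inr (branch_mem_middleRegion true hp))
    fun _ hp => branch_mem_middleRegion false hp
  have hlowL := decaysOn_centralDeriv_of_branches hr.le hθ hrθ (Q := lowerLeft P)
    (Q' := middleRegion P ∪ upperLeft P) (hmid.union hθ.le hupL)
    (fun _ hp => (branch_true_mem_of_lowerLeft hp).imp_right Or.inl)
    fun _ hp => Or.inr ⟨branch_false_not_mem_low hp.1, y_branch_le_half false hp⟩
  have hupR := decaysOn_centralDeriv_of_branches hr.le hθ hrθ (Q := upperRight P) hlowL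
    (fun _ hp => Or.inr (branch_mem_lowerLeft true hp))
    fun _ hp => branch_mem_lowerLeft false hp
  have hlowR := decaysOn_centralDeriv_of_branches hr.le hθ hrθ (Q := lowerRight P) hupR
    (fun p hp => Or.inl ⟨branch_true_mem_low p, le_y_branch true hp⟩)
    fun _ hp => ⟨branch_false_not_mem_low hp.1, by
      linarith [le_y_branch false hp, P.σ_lt]⟩
  exact ((((hmid.union hθ.le hupL).union hθ.le hlowL).union hθ.le hupR).union hθ.le hlowR).mono
    fun s _ => regions_cover s.1.2

end CentralDecay

/-! ### Contraction on average -/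

section AverageContraction

variable {φ : C(Lam P, ℝ)} {r θ : ℝ}

theorem cocycleSum_comp_fst_eq_diag (k : Lam P → ℝ) (j m : ℕ) (s : SamePlane P) :
    cocycleSum φ (fun s => k s.1.1) j m s
      = cocycleSum φ (fun s => k s.1.2) j m ⟨(s.1.1, s.1.1), Iff.rfl⟩ :=
  (cocycleSum_comp_fst k j m s).trans <|
    congrFun (branchSum_pow_comp (β := branch) (β' := branchPair)
      (k := fun i s => branchWeight φ i s.1.1 * k s.1.2)
      (π := fun p : Lam P => (⟨(p, p), Iff.rfl⟩ : SamePlane P))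
      (fun _ _ => rfl) (fun s => perronIter φ m s.1.1) j) s.1.1

theorem DecaysOn.comp_fst {k : Lam P → ℝ}
    (h : DecaysOn φ (fun s => k s.1.2) θ Set.univ) :
    DecaysOn φ (fun s => k s.1.1) θ Set.univ := by
  obtain ⟨C, hC, h⟩ := h
  refine ⟨C, hC, fun j m s _ => ?_⟩
  rw [cocycleSum_comp_fst_eq_diag]
  exact h j m _ trivial

theorem decaysOn_sqrt_centralDeriv_mul (hθ : 0 ≤ θ)
    (h : DecaysOn φ (fun s => centralDeriv s.1.2 ^ r) θ Set.univ) :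
    DecaysOn φ (fun s => (Real.sqrt (centralDeriv s.1.1) * Real.sqrt (centralDeriv s.1.2)) ^ r) θ
      Set.univ := by
  have hfst := DecaysOn.comp_fst (k := fun p => centralDeriv p ^ r) h
  have hmean := hfst.rpow_mul_rpow one_half_pos one_half_lt_one
    (fun s => Real.rpow_nonneg (centralDeriv_nonneg s.1.1) r)
    (fun s => Real.rpow_nonneg (centralDeriv_nonneg s.1.2) r) hθ hθ h
  have hsqrt (p : Lam P) : Real.sqrt (centralDeriv p ^ r) = Real.sqrt (centralDeriv p) ^ r := by
    rw [Real.sqrt_eq_rpow, Real.sqrt_eq_rpow, ← Real.rpow_mul (centralDeriv_nonneg p),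
      ← Real.rpow_mul (centralDeriv_nonneg p), mul_comm]
  simp only [sub_half, ← Real.sqrt_eq_rpow, hsqrt, Real.mul_self_sqrt hθ] at hmean
  simpa only [Real.mul_rpow (Real.sqrt_nonneg _) (Real.sqrt_nonneg _)] using hmean

/-- The transfer operator acting on functions of pairs of points, with the weights of the first
point. -/
noncomputable def pairTransferOp (φ : C(Lam P, ℝ)) : Module.End ℝ (SamePlane P → ℝ) :=
  branchSum branchPair fun i s => branchWeight φ i s.1.1

theorem pairTransferOp_mono (φ : C(Lam P, ℝ)) : Monotone (pairTransferOp φ) :=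
  branchSum_mono fun i s => (branchWeight_pos φ i s.1.1).le

/-- The function `w` of pairs of points is contracted by the factor `θ`, on average over the
inverse branches weighted as in `perronIter`. -/
def ContractsOnAverage (φ : C(Lam P, ℝ)) (w : SamePlane P → ℝ) (θ : ℝ) : Prop :=
  ∃ C : ℝ, 0 ≤ C ∧ ∀ j m s, (pairTransferOp φ ^ j) (w * fun s => perronIter φ m s.1.1) s
    ≤ C * θ ^ j * ‖perronIter φ (j + m)‖ * w s

theorem DecaysOn.contractsOnAverage {d w : SamePlane P → ℝ} (hw0 : 0 ≤ w)
    (hw : ∀ i s, w (branchPair i s) = d s * w s) (h : DecaysOn φ d θ Set.univ) :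
    ContractsOnAverage φ w θ := by
  obtain ⟨C, hC, h⟩ := h
  refine ⟨C, hC, fun j m s => ?_⟩
  have hcocycle := congrFun (mul_cocycleSum (φ := φ) (d := d) (d' := 1) (w := w)
    (fun i s => by rw [hw, Pi.one_apply, one_mul, mul_comm]) j m) s
  simp only [Pi.one_apply, mul_one] at hcocycle
  rw [pairTransferOp, ← hcocycle, mul_comm _ (w s)]
  exact mul_le_mul_of_nonneg_left (h j m s trivial) (hw0 s)

theorem ContractsOnAverage.of_le_add {w w₁ w₂ : SamePlane P → ℝ} (hθ : 0 ≤ θ)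
    (hw : w ≤ w₁ + w₂) (hw₁ : w₁ ≤ w) (hw₂ : w₂ ≤ w) (h₁ : ContractsOnAverage φ w₁ θ)
    (h₂ : ContractsOnAverage φ w₂ θ) : ContractsOnAverage φ w θ := by
  obtain ⟨C₁, hC₁, h₁⟩ := h₁
  obtain ⟨C₂, hC₂, h₂⟩ := h₂
  refine ⟨C₁ + C₂, add_nonneg hC₁ hC₂, fun j m s => ?_⟩
  set F : SamePlane P → ℝ := fun s => perronIter φ m s.1.1
  have hF : 0 ≤ F := fun s => (perronIter_pos φ m s.1.1).le
  set N := ‖perronIter φ (j + m)‖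
  calc (pairTransferOp φ ^ j) (w * F) s ≤ (pairTransferOp φ ^ j) ((w₁ + w₂) * F) s :=
        monotone_end_pow (pairTransferOp_mono φ) j (mul_le_mul_of_nonneg_right hw hF) s
    _ = (pairTransferOp φ ^ j) (w₁ * F) s + (pairTransferOp φ ^ j) (w₂ * F) s := by
        rw [add_mul, map_add, Pi.add_apply]
    _ ≤ C₁ * θ ^ j * N * w₁ s + C₂ * θ ^ j * N * w₂ s := add_le_add (h₁ j m s) (h₂ j m s)
    _ ≤ C₁ * θ ^ j * N * w s + C₂ * θ ^ j * N * w s := by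
        gcongr
        exacts [hw₁ s, hw₂ s]
    _ = (C₁ + C₂) * θ ^ j * N * w s := by ring

theorem contractsOnAverage_abs_x_sub (hρθ : P.ρ ^ r ≤ θ) :
    ContractsOnAverage φ (fun s => |s.1.1.1.1 - s.1.2.1.1| ^ r) θ := by
  have hρ := Real.rpow_nonneg P.ρ_pos.le r
  have hdecay := (DecaysOn.one (φ := φ)).smul hρ
  rw [mul_one] at hdecay
  refine (hdecay.mono_rate hρ hρθ).contractsOnAverage
    (fun _ => Real.rpow_nonneg (abs_nonneg _) r) fun i s => ?_
  rw [Pi.smul_apply, Pi.one_apply, smul_eq_mul, mul_one, ← Real.mul_rpow P.ρ_pos.le (abs_nonneg _),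
    ← abs_x_branch_sub i s.2]
  rfl

theorem contractsOnAverage_abs_y_sub (hθ : 0 ≤ θ)
    (h : DecaysOn φ (fun s => centralDeriv s.1.2 ^ r) θ Set.univ) :
    ContractsOnAverage φ (fun s => |s.1.1.1.2.1 - s.1.2.1.2.1| ^ r) θ := by
  refine (decaysOn_sqrt_centralDeriv_mul hθ h).contractsOnAverage
    (fun _ => Real.rpow_nonneg (abs_nonneg _) r) fun i s => ?_
  rw [← Real.mul_rpow (mul_nonneg (Real.sqrt_nonneg _) (Real.sqrt_nonneg _)) (abs_nonneg _),
    ← abs_y_branch_sub i s.2]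
  rfl

theorem contractsOnAverage_dist (hr : 0 ≤ r) (hθ : 0 ≤ θ) (hρθ : P.ρ ^ r ≤ θ)
    (h : DecaysOn φ (fun s => centralDeriv s.1.2 ^ r) θ Set.univ) :
    ContractsOnAverage φ (fun s => dist s.1.1 s.1.2 ^ r) θ := by
  refine (contractsOnAverage_abs_x_sub hρθ).of_le_add hθ (fun s => ?_) (fun s => ?_) (fun s => ?_)
    (contractsOnAverage_abs_y_sub hθ h) <;> beta_reduce <;> rw [dist_eq_max s.2]
  · rcases max_choice |s.1.1.1.1 - s.1.2.1.1| |s.1.1.1.2.1 - s.1.2.1.2.1| with hmax | hmax <;>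
      rw [hmax]
    exacts [le_add_of_nonneg_right (Real.rpow_nonneg (abs_nonneg _) r),
      le_add_of_nonneg_left (Real.rpow_nonneg (abs_nonneg _) r)]
  · exact Real.rpow_le_rpow (abs_nonneg _) (le_max_left _ _) hr
  · exact Real.rpow_le_rpow (abs_nonneg _) (le_max_right _ _) hr

theorem exists_contractsOnAverage_dist (hφ : Real.exp (⨆ x, φ x) < lowerRate φ) :
    ∃ r₀ > (0 : ℝ), ∀ r, 0 < r → r ≤ r₀ →
      ∃ θ, 0 < θ ∧ θ < 1 ∧ ContractsOnAverage φ (fun s => dist s.1.1 s.1.2 ^ r) θ := by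
  have hrate := lowerRate_pos φ
  obtain ⟨c, hc, hcrate⟩ := exists_between ((Real.lt_log_iff_exp_lt hrate).2 hφ)
  rw [Real.lt_log_iff_exp_lt hrate] at hcrate
  obtain ⟨θ₁, hcθ₁, hθ₁⟩ := exists_between ((div_lt_one hrate).2 hcrate)
  rw [div_lt_iff₀ hrate] at hcθ₁
  refine ⟨min 1 (c - ⨆ x, φ x), lt_min one_pos (sub_pos.2 hc), fun r hr0 hr => ?_⟩
  have hr1 : r ≤ 1 := hr.trans (min_le_left _ _)
  obtain ⟨θ₀, ⟨hθ₀, hθ₀1⟩, hlogit⟩ := exists_decaysOn_logitDeriv_rpow hφ hr0 hr1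
  set θ := max θ₀ (max θ₁ (P.ρ ^ r))
  have hθ0 : 0 < θ := lt_max_of_lt_left hθ₀
  have hθ₁θ : θ₁ ≤ θ := le_max_of_le_right (le_max_left _ _)
  have hρθ : P.ρ ^ r ≤ θ := le_max_of_le_right (le_max_right _ _)
  have hρ1 : P.ρ ^ r < 1 := Real.rpow_lt_one P.ρ_pos.le (P.ρ_lt.trans (by norm_num)) hr0
  have hrθ : Real.exp (⨆ x, φ x) * Real.exp r < θ * lowerRate φ := by
    calc Real.exp (⨆ x, φ x) * Real.exp r ≤ Real.exp c := by
          rw [← Real.exp_add, Real.exp_le_exp]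
          linarith [hr.trans (min_le_right _ _)]
      _ < θ₁ * lowerRate φ := hcθ₁
      _ ≤ θ * lowerRate φ := by gcongr
  refine ⟨θ, hθ0, max_lt hθ₀1 (max_lt hθ₁ hρ1), contractsOnAverage_dist hr0.le hθ0.le hρθ ?_⟩
  exact decaysOn_centralDeriv_snd hr0 hθ0 hrθ (hlogit.mono_rate hθ₀.le (le_max_left _ _))

end AverageContraction

/-! ### Bounded distortion -/

section Distortion

variable {φ : C(Lam P, ℝ)} {r θ : ℝ} {w : SamePlane P → ℝ}

theorem ContractsOnAverage.smul {c : ℝ} (hc : 0 ≤ c) (h : ContractsOnAverage φ w θ) :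
    ContractsOnAverage φ (c • w) θ := by
  obtain ⟨C, hC, h⟩ := h
  refine ⟨C, hC, fun j m s => ?_⟩
  rw [smul_mul_assoc, map_smul, Pi.smul_apply, Pi.smul_apply, smul_eq_mul, smul_eq_mul,
    mul_left_comm]
  exact mul_le_mul_of_nonneg_left (h j m s) hc

/-- If `w` bounds the variation of `φ` over pairs of points, the accumulated difference of the
weights of the branches of order `n` at the two points of a pair, weighted as in `perronIter`. -/
noncomputable def distortion (φ : C(Lam P, ℝ)) (w : SamePlane P → ℝ) : ℕ → SamePlane P → ℝ
  | 0 => 0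
  | n + 1 => pairTransferOp φ ((w * fun s => perronIter φ n s.1.1) + distortion φ w n)

theorem ContractsOnAverage.exists_pow_distortion_le (hw : 0 ≤ w) (hθ0 : 0 ≤ θ) (hθ1 : θ < 1)
    (h : ContractsOnAverage φ w θ) :
    ∃ D, 0 ≤ D ∧ ∀ n j s, (pairTransferOp φ ^ j) (distortion φ w n) s
      ≤ D * θ ^ j * ‖perronIter φ (j + n)‖ * w s := by
  obtain ⟨C, hC, h⟩ := h
  have hθ : 0 < 1 - θ := sub_pos.2 hθ1
  refine ⟨C / (1 - θ), by positivity, fun n => ?_⟩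
  induction n with
  | zero =>
    intro j s
    have hs : 0 ≤ w s := hw s
    rw [distortion, map_zero, Pi.zero_apply]
    positivity
  | succ n ih =>
    intro j s
    have hsum : (C + C / (1 - θ)) * θ ≤ C / (1 - θ) := by
      rw [← sub_nonneg]
      refine (mul_nonneg hC hθ.le).trans_eq ?_
      field_simp
      ring
    have hs : 0 ≤ w s := hw s
    set N := ‖perronIter φ (j + (n + 1))‖
    have hstep := h (j + 1) n s
    have hrec := ih (j + 1) s
    rw [Nat.add_right_comm, Nat.add_assoc] at hstep hrec
    calc (pairTransferOp φ ^ j) (distortion φ w (n + 1)) s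
        = (pairTransferOp φ ^ (j + 1)) (w * fun s => perronIter φ n s.1.1) s
          + (pairTransferOp φ ^ (j + 1)) (distortion φ w n) s := by
          rw [distortion, ← Module.End.mul_apply, ← pow_succ, map_add, Pi.add_apply]
      _ ≤ C * θ ^ (j + 1) * N * w s + C / (1 - θ) * θ ^ (j + 1) * N * w s := add_le_add hstep hrec
      _ = (C + C / (1 - θ)) * θ * (θ ^ j * N * w s) := by ring
      _ ≤ C / (1 - θ) * (θ ^ j * N * w s) := by gcongr
      _ = C / (1 - θ) * θ ^ j * N * w s := by ring

theorem ContractsOnAverage.exists_distortion_le (hw : 0 ≤ w) (hθ0 : 0 ≤ θ) (hθ1 : θ < 1)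
    (h : ContractsOnAverage φ w θ) :
    ∃ D, 0 ≤ D ∧ ∀ n s, distortion φ w n s ≤ D * ‖perronIter φ n‖ * w s := by
  obtain ⟨D, hD, h⟩ := h.exists_pow_distortion_le hw hθ0 hθ1
  exact ⟨D, hD, fun n s => by simpa using h n 0 s⟩

theorem sum_mul_exp_neg_div_le {ι : Type*} [Fintype ι] {a x : ι → ℝ} (ha : 0 ≤ a)
    (hpos : 0 < ∑ i, a i) :
    (∑ i, a i) * Real.exp (-((∑ i, a i * x i) / ∑ i, a i)) ≤ ∑ i, a i * Real.exp (-x i) := by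
  have h := convexOn_exp.map_centerMass_le (p := fun i => -x i) (fun i _ => ha i) hpos
    fun _ _ => Set.mem_univ _
  simp only [Finset.centerMass, smul_eq_mul, Function.comp_apply, mul_neg, Finset.sum_neg_distrib,
    inv_mul_eq_div] at h
  exact (le_div_iff₀' hpos).1 h

theorem branchWeight_mul_exp_neg_le (hφ : ∀ s : SamePlane P, φ s.1.1 - φ s.1.2 ≤ w s) (i : Bool)
    (s : SamePlane P) :
    branchWeight φ i s.1.1 * Real.exp (-w (branchPair i s)) ≤ branchWeight φ i s.1.2 := by
  rw [branchWeight, branchWeight, branchMult_congr s.2, mul_assoc, ← Real.exp_add]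
  refine mul_le_mul_of_nonneg_left (Real.exp_le_exp.2 ?_) (branchMult_pos _).le
  have hi : φ (branch i s.1.1) - φ (branch i s.1.2) ≤ w (branchPair i s) := hφ (branchPair i s)
  linarith

theorem perronVector_congr (s : SamePlane P) : perronVector P s.1.1 = perronVector P s.1.2 := by
  by_cases hs : s.1.1 ∈ low P
  · rw [perronVector_low hs, perronVector_low (s.2.1 hs)]
  · rw [perronVector_up hs, perronVector_up (mt s.2.2 hs)]

theorem perronIter_mul_exp_neg_distortion_le
    (hφ : ∀ s : SamePlane P, φ s.1.1 - φ s.1.2 ≤ w s) (n : ℕ) (s : SamePlane P) :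
    perronIter φ n s.1.1 * Real.exp (-(distortion φ w n s / perronIter φ n s.1.1))
      ≤ perronIter φ n s.1.2 := by
  induction n generalizing s with
  | zero =>
    rw [perronIter_zero, perronVector_congr, distortion, Pi.zero_apply, zero_div, neg_zero,
      Real.exp_zero, mul_one]
  | succ n ih =>
    set a : Bool → ℝ := fun i => branchWeight φ i s.1.1 * perronIter φ n (branch i s.1.1)
    set x : Bool → ℝ := fun i =>
      w (branchPair i s) + distortion φ w n (branchPair i s) / perronIter φ n (branch i s.1.1)
    have ha : 0 ≤ a := fun i => mul_nonneg (branchWeight_pos φ i _).le (perronIter_pos φ n _).le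
    have hsum : perronIter φ (n + 1) s.1.1 = ∑ i, a i := by rw [perronIter_succ]; rfl
    have hdist : distortion φ w (n + 1) s = ∑ i, a i * x i := by
      rw [distortion, pairTransferOp, branchSum_apply]
      refine Finset.sum_congr rfl fun i _ => ?_
      have hi := (perronIter_pos φ n (branch i s.1.1)).ne'
      change branchWeight φ i s.1.1 * (w (branchPair i s) * perronIter φ n (branch i s.1.1)
        + distortion φ w n (branchPair i s)) = _
      simp only [a, x]
      field_simp
    have hterm (i : Bool) : a i * Real.exp (-x i)
        ≤ branchWeight φ i s.1.2 * perronIter φ n (branch i s.1.2) := by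
      rw [neg_add, Real.exp_add, mul_mul_mul_comm]
      exact mul_le_mul (branchWeight_mul_exp_neg_le hφ i s) (ih (branchPair i s))
        (mul_nonneg (perronIter_pos φ n _).le (Real.exp_pos _).le) (branchWeight_pos φ i _).le
    rw [hdist, hsum, perronIter_succ, branchSum_apply]
    exact (sum_mul_exp_neg_div_le ha (hsum ▸ perronIter_pos φ (n + 1) s.1.1)).trans
      (Finset.sum_le_sum fun i _ => hterm i)

theorem perronIter_sub_le_distortion (hφ : ∀ s : SamePlane P, φ s.1.1 - φ s.1.2 ≤ w s) (n : ℕ)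
    (s : SamePlane P) : perronIter φ n s.1.1 - perronIter φ n s.1.2 ≤ distortion φ w n s := by
  have hpos := perronIter_pos φ n s.1.1
  have hexp := mul_le_mul_of_nonneg_left
    (Real.one_sub_le_exp_neg (distortion φ w n s / perronIter φ n s.1.1)) hpos.le
  rw [mul_sub, mul_one, mul_div_cancel₀ _ hpos.ne'] at hexp
  linarith [perronIter_mul_exp_neg_distortion_le hφ n s]

theorem abs_perronIter_sub_le {D : ℝ} (hD : 0 ≤ D) (hr1 : r ≤ 1)
    (h : ∀ n (s : SamePlane P), perronIter φ n s.1.1 - perronIter φ n s.1.2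
      ≤ D * ‖perronIter φ n‖ * dist s.1.1 s.1.2 ^ r) (n : ℕ) (p q : Lam P) :
    |perronIter φ n p - perronIter φ n q| ≤ (D + 2) * ‖perronIter φ n‖ * dist p q ^ r := by
  have hN := norm_nonneg (perronIter φ n)
  have hdist (p q : Lam P) : 0 ≤ dist p q ^ r := Real.rpow_nonneg dist_nonneg r
  have hsub (p q : Lam P) : perronIter φ n p - perronIter φ n q
      ≤ (D + 2) * ‖perronIter φ n‖ * dist p q ^ r := by
    by_cases hpq : p ∈ low P ↔ q ∈ low P
    · refine (h n ⟨(p, q), hpq⟩).trans (mul_le_mul_of_nonneg_right ?_ (hdist p q))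
      exact mul_le_mul_of_nonneg_right (le_add_of_nonneg_right zero_le_two) hN
    · have hfar := dist_of_not_iff hpq
      have hhalf : 1 / 2 ≤ dist p q ^ r :=
        (by linarith : 1 / 2 ≤ dist p q).trans
          (Real.self_le_rpow_of_le_one dist_nonneg (dist_le_one p q) hr1)
      calc perronIter φ n p - perronIter φ n q ≤ ‖perronIter φ n‖ := by
            linarith [perronIter_le_norm φ n p, perronIter_pos φ n q]
        _ = 2 * ‖perronIter φ n‖ * (1 / 2) := by ring
        _ ≤ (D + 2) * ‖perronIter φ n‖ * dist p q ^ r := by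
            gcongr
            exact le_add_of_nonneg_left hD
  rw [abs_sub_le_iff]
  exact ⟨hsub p q, by rw [dist_comm]; exact hsub q p⟩

end Distortion

/-! ### Lower bound -/

section LowerBound

variable {φ : C(Lam P, ℝ)} {D K r θ : ℝ}

theorem perronIter_lt_norm_of_not_mem_low (hφ : Real.exp (⨆ x, φ x) < lowerRate φ) {p : Lam P}
    (hp : p ∉ low P) (n : ℕ) : perronIter φ n p < ‖perronIter φ n‖ := by
  cases n with
  | zero =>
    have h := perronIter_le_norm φ 0 (branch true p)
    rw [perronIter_zero, perronVector_low (branch_true_mem_low p)] at h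
    rw [perronIter_zero, perronVector_up hp]
    exact Real.one_lt_goldenRatio.trans_le h
  | succ n =>
    have hN : 0 < ‖perronIter φ n‖ := (perronIter_pos φ n p).trans_le (perronIter_le_norm φ n p)
    have hterm i : branchWeight φ i p * perronIter φ n (branch i p)
        ≤ Real.exp (⨆ x, φ x) * (1 / 2) * ‖perronIter φ n‖ :=
      mul_le_mul ((branchWeight_le φ i p).trans_eq (by rw [branchMult_up hp]))
        (perronIter_le_norm φ n _) (perronIter_pos φ n _).le (by positivity)
    calc perronIter φ (n + 1) p
        = branchWeight φ true p * perronIter φ n (branch true p)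
          + branchWeight φ false p * perronIter φ n (branch false p) := by
          rw [perronIter_succ, branchSum_apply, Fintype.sum_bool]
      _ ≤ Real.exp (⨆ x, φ x) * ‖perronIter φ n‖ := by linarith [hterm true, hterm false]
      _ < lowerRate φ * ‖perronIter φ n‖ := mul_lt_mul_of_pos_right hφ hN
      _ ≤ ‖perronIter φ (n + 1)‖ := lowerRate_mul_norm_perronIter_le φ n

theorem norm_perronIter_pos [Nonempty (Lam P)] (φ : C(Lam P, ℝ)) (n : ℕ) :
    0 < ‖perronIter φ n‖ :=
  (perronIter_pos φ n (Classical.arbitrary _)).trans_le (perronIter_le_norm φ n _)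

theorem exists_mem_low_perronIter_eq_norm [Nonempty (Lam P)]
    (hφ : Real.exp (⨆ x, φ x) < lowerRate φ) (n : ℕ) :
    ∃ p ∈ low P, perronIter φ n p = ‖perronIter φ n‖ := by
  by_contra! hne
  refine lt_irrefl ‖perronIter φ n‖ <|
    (ContinuousMap.norm_lt_iff _ (norm_perronIter_pos φ n)).2 fun p => ?_
  rw [Real.norm_of_nonneg (perronIter_pos φ n p).le]
  by_cases hp : p ∈ low P
  · exact (perronIter_le_norm φ n p).lt_of_ne (hne p hp)
  · exact perronIter_lt_norm_of_not_mem_low hφ hp n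

theorem exp_neg_mul_norm_perronIter_le_of_mem_low [Nonempty (Lam P)]
    (hφ : Real.exp (⨆ x, φ x) < lowerRate φ) (n : ℕ)
    (h : ∀ s : SamePlane P, perronIter φ n s.1.1 * Real.exp (-(D * ‖perronIter φ n‖ /
      perronIter φ n s.1.1)) ≤ perronIter φ n s.1.2) {q : Lam P} (hq : q ∈ low P) :
    Real.exp (-D) * ‖perronIter φ n‖ ≤ perronIter φ n q := by
  obtain ⟨p, hp, hmax⟩ := exists_mem_low_perronIter_eq_norm hφ n
  have hpq := h ⟨(p, q), iff_of_true hp hq⟩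
  rwa [hmax, mul_div_cancel_right₀ _ (norm_perronIter_pos φ n).ne', mul_comm] at hpq

theorem exp_iInf_mul_le_perronIter_succ (φ : C(Lam P, ℝ)) {p : Lam P} (hp : p ∉ low P) (n : ℕ)
    {b : ℝ} (hb0 : 0 ≤ b) (hb : ∀ q ∈ low P, b ≤ perronIter φ n q) :
    Real.exp (⨅ x, φ x) * b ≤ perronIter φ (n + 1) p := by
  have hterm (i : Bool) : 1 / 2 * (Real.exp (⨅ x, φ x) * b)
      ≤ branchWeight φ i p * perronIter φ n (branch i p) := by
    rw [branchWeight, branchMult_up hp, mul_assoc]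
    exact mul_le_mul_of_nonneg_left
      (mul_le_mul (exp_iInf_le_exp φ _) (hb _ (branch_mem_low_of_not_mem_low i hp)) hb0
        (Real.exp_pos _).le) one_half_pos.le
  rw [perronIter_succ, branchSum_apply, Fintype.sum_bool]
  linarith [hterm true, hterm false]

theorem mul_norm_perronIter_le_of_forall_mem_low {c : ℝ} (hc0 : 0 ≤ c) (hc1 : c ≤ 1)
    (h : ∀ n, ∀ q ∈ low P, c * ‖perronIter φ n‖ ≤ perronIter φ n q) (n : ℕ) (p : Lam P) :
    c * Real.exp ((⨅ x, φ x) - ⨆ x, φ x) / 2 * ‖perronIter φ n‖ ≤ perronIter φ n p := by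
  set κ := Real.exp ((⨅ x, φ x) - ⨆ x, φ x)
  have hκsup : κ * Real.exp (⨆ x, φ x) = Real.exp (⨅ x, φ x) := by
    rw [← Real.exp_add, sub_add_cancel]
  have : 0 ≤ κ := (Real.exp_pos _).le
  have hκ1 : κ ≤ 1 :=
    Real.exp_le_one_iff.2 <| sub_nonpos.2 <|
      Real.exp_le_exp.1 ((exp_iInf_le_exp φ p).trans (exp_le_exp_iSup φ p))
  by_cases hp : p ∈ low P
  · refine (mul_le_mul_of_nonneg_right ?_ (norm_nonneg _)).trans (h n p hp)
    linarith [mul_le_of_le_one_right hc0 hκ1]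
  cases n with
  | zero =>
    rw [perronIter_zero, perronVector_up hp]
    calc c * κ / 2 * ‖perronVector P‖ ≤ 1 * 1 / 2 * 2 := by
          gcongr
          exact norm_perronVector_le.trans Real.goldenRatio_lt_two.le
      _ = 1 := by norm_num
  | succ n =>
    calc c * κ / 2 * ‖perronIter φ (n + 1)‖
        ≤ c * κ / 2 * (2 * Real.exp (⨆ x, φ x) * ‖perronIter φ n‖) := by
          gcongr
          exact norm_perronIter_succ_le φ n
      _ = Real.exp (⨅ x, φ x) * (c * ‖perronIter φ n‖) := by
          rw [← hκsup]
          ring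
      _ ≤ perronIter φ (n + 1) p :=
          exp_iInf_mul_le_perronIter_succ φ hp n (by positivity) (h n)

/-! ### Conclusion -/

theorem nonempty_Lam (P : Params) : Nonempty (Lam P) := by
  have h0 : ((0 : ℝ), (0 : ℝ), (0 : ℝ)) ∈ R₁ P :=
    ⟨⟨le_rfl, P.ρ_pos.le⟩, ⟨le_rfl, zero_le_one⟩, rfl⟩
  have hfix : Gmap P (0, 0, 0) = (0, 0, 0) := by
    rw [Gmap_R₁ h0]
    simp [g₀]
  refine ⟨⟨(0, 0, 0), mem_Lam.2 fun n => ?_⟩⟩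
  rw [Function.iterate_fixed hfix n]
  exact Or.inl (Or.inl h0)

theorem exists_forall_abs_sub_le_of_isHolder {u : Lam P → ℝ} (hu : IsHolder u) {r₀ : ℝ}
    (hr₀ : 0 < r₀) :
    ∃ K r : ℝ, 0 ≤ K ∧ 0 < r ∧ r ≤ r₀ ∧ r ≤ 1 ∧ ∀ p q, |u p - u q| ≤ K * dist p q ^ r := by
  obtain ⟨K, s, hs, hs1, h⟩ := hu
  refine ⟨K, min s r₀, K.2, lt_min hs hr₀, min_le_right _ _, (min_le_left _ _).trans hs1,
    fun p q => (h.dist_le p q).trans (mul_le_mul_of_nonneg_left ?_ K.2)⟩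
  exact Real.rpow_le_rpow_of_exponent_ge' dist_nonneg (dist_le_one p q)
    (lt_min (NNReal.coe_pos.2 hs) hr₀).le (min_le_left _ _)

theorem exp_iSup_lt_lowerRate (hvar : (⨆ x, φ x) - (⨅ x, φ x) < Real.log goldenRatio) :
    Real.exp (⨆ x, φ x) < lowerRate φ := by
  rwa [lowerRate, ← div_lt_iff₀ (Real.exp_pos _), ← Real.exp_sub,
    ← Real.lt_log_iff_exp_lt Real.goldenRatio_pos]

theorem exists_distortion_le_of_isHolder (hφ : IsHolder φ)
    (hgap : Real.exp (⨆ x, φ x) < lowerRate φ) :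
    ∃ w : SamePlane P → ℝ, ∃ D r : ℝ, 0 ≤ D ∧ 0 < r ∧ r ≤ 1 ∧
      (∀ s, φ s.1.1 - φ s.1.2 ≤ w s) ∧
      ∀ n s, distortion φ w n s ≤ D * ‖perronIter φ n‖ * dist s.1.1 s.1.2 ^ r := by
  obtain ⟨r₀, hr₀, hcontr⟩ := exists_contractsOnAverage_dist hgap
  obtain ⟨K, r, hK, hr, hrr₀, hr1, hφK⟩ := exists_forall_abs_sub_le_of_isHolder hφ hr₀
  obtain ⟨θ, hθ0, hθ1, hθ⟩ := hcontr r hr hrr₀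
  set d : SamePlane P → ℝ := fun s => dist s.1.1 s.1.2 ^ r
  have hd : 0 ≤ d := fun s => Real.rpow_nonneg dist_nonneg r
  obtain ⟨D, hD, hdist⟩ :=
    (hθ.smul hK).exists_distortion_le (smul_nonneg hK hd) hθ0.le hθ1
  refine ⟨K • d, D * K, r, mul_nonneg hD hK, hr, hr1,
    fun s => (le_abs_self _).trans (hφK s.1.1 s.1.2), fun n s => (hdist n s).trans_eq ?_⟩
  rw [Pi.smul_apply, smul_eq_mul]
  ring

theorem exists_mul_norm_perronIter_le [Nonempty (Lam P)]
    (hgap : Real.exp (⨆ x, φ x) < lowerRate φ) {w : SamePlane P → ℝ}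
    (hw : ∀ s : SamePlane P, φ s.1.1 - φ s.1.2 ≤ w s) (hD : 0 ≤ D)
    (hdist : ∀ n s, distortion φ w n s ≤ D * ‖perronIter φ n‖) :
    ∃ c, 0 < c ∧ ∀ n p, c * ‖perronIter φ n‖ ≤ perronIter φ n p := by
  refine ⟨_, by positivity, mul_norm_perronIter_le_of_forall_mem_low (Real.exp_pos (-D)).le
    (Real.exp_le_one_iff.2 (neg_nonpos.2 hD)) fun n q hq =>
      exp_neg_mul_norm_perronIter_le_of_mem_low hgap n (fun s => ?_) hq⟩
  refine le_trans ?_ (perronIter_mul_exp_neg_distortion_le hw n s)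
  have := perronIter_pos φ n s.1.1
  gcongr
  exact hdist n s

theorem exists_isBalanced_perronVector [Nonempty (Lam P)] (hφ : IsHolder φ)
    (hgap : Real.exp (⨆ x, φ x) < lowerRate φ) :
    ∃ c D r : ℝ, IsBalanced (transferOp φ) (perronVector P) c ∧ 0 ≤ D ∧ 0 < r ∧ r ≤ 1 ∧
      ∀ n p q, |(transferOp φ ^ n) (perronVector P) p - (transferOp φ ^ n) (perronVector P) q|
        ≤ D * ‖(transferOp φ ^ n) (perronVector P)‖ * dist p q ^ r := by
  obtain ⟨w, D, r, hD, hr, hr1, hw, hdist⟩ := exists_distortion_le_of_isHolder hφ hgap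
  obtain ⟨c, hc, hlower⟩ := exists_mul_norm_perronIter_le hgap hw hD fun n s =>
    (hdist n s).trans (mul_le_of_le_one_right (by positivity)
      (Real.rpow_le_one dist_nonneg (dist_le_one _ _) hr.le))
  exact ⟨c, D + 2, r, ⟨hc, one_le_perronVector, norm_perronIter_pos φ, hlower⟩, by positivity,
    hr, hr1, abs_perronIter_sub_le hD hr1 fun n s =>
      (perronIter_sub_le_distortion hw n s).trans (hdist n s)⟩

theorem isDualTransfer_smul {ν : MeasureTheory.Measure (Lam P)} {l : ℝ} (hl : 0 ≤ l)
    (h : ∀ ψ, ∫ x, transferOp φ ψ x ∂ν = l * ∫ x, ψ x ∂ν) :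
    IsDualTransfer φ ν (ENNReal.ofReal l • ν) := fun ψ => by
  rw [MeasureTheory.integral_smul_measure, ENNReal.toReal_ofReal hl, h, smul_eq_mul]

end LowerBound

end HorseshoeProjection

open HorseshoeProjection in
theorem theoremB_general (P : Params)
    (φ : C(Lam P, ℝ))
    (hφ : IsHolder φ)
    (hvar : (⨆ x, φ x) - (⨅ x, φ x) < Real.log ((1 + Real.sqrt 5) / 2)) :
    ∃ (ν : MeasureTheory.Measure (Lam P))
      (h : C(Lam P, ℝ)),
      MeasureTheory.IsProbabilityMeasure ν ∧
      IsDualTransfer φ ν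
        (ENNReal.ofReal
          (spectralRad (transferOp φ)) • ν) ∧
      (∀ x, 0 < h x) ∧
      IsHolder h ∧
      transferOp φ h
        = spectralRad (transferOp φ) • h := by
  have := nonempty_Lam P
  have hmono := transferOp_mono φ
  obtain ⟨c, D, r, hbal, hD, hr0, hr1, hhol⟩ :=
    exists_isBalanced_perronVector hφ (exp_iSup_lt_lowerRate hvar)
  have hrad := (hbal.isQuasiMultiplicative hmono).spectralRad_pos_and_norm_pow_bounds.1
  obtain ⟨ν, hν, hdual⟩ := hbal.exists_eigenmeasure hmono
  obtain ⟨h, hpos, hh, heig⟩ := hbal.exists_eigenfunction hmono hD hr0 hr1 hhol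
  exact ⟨ν, h, hν, isDualTransfer_smul hrad.le hdual, hpos, hh, heig⟩

theorem theoremB (P : HorseshoeProjection.Params)
    (φ : C(HorseshoeProjection.Lam P, ℝ))
    (hφ : HorseshoeProjection.IsHolder φ)
    (hvar : (⨆ x, φ x) - (⨅ x, φ x) < Real.log ((1 + Real.sqrt 5) / 2) / 2) :
    ∃ (ν : MeasureTheory.Measure (HorseshoeProjection.Lam P))
      (h : C(HorseshoeProjection.Lam P, ℝ)),
      MeasureTheory.IsProbabilityMeasure ν ∧
      HorseshoeProjection.IsDualTransfer φ ν
        (ENNReal.ofReal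
          (HorseshoeProjection.spectralRad (HorseshoeProjection.transferOp φ)) • ν) ∧
      (∀ x, 0 < h x) ∧
      HorseshoeProjection.IsHolder h ∧
      HorseshoeProjection.transferOp φ h
        = HorseshoeProjection.spectralRad (HorseshoeProjection.transferOp φ) • h :=
  theoremB_general P φ hφ
    (hvar.trans (half_lt_self (Real.log_pos Real.one_lt_goldenRatio)))
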